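/- \textbf{Definitions.} A \emph{duoidal} structure on a category $\mathsf C$ with two monoidal structures $(\diamond,I)$, $(\star,J)$ (in this order) consists of a natural transformation (interchange law) $\zeta:(A\star B)\diamond(X\star Y)\to(A\diamond X)\star(B\diamond Y)$ and unit maps $\Delta:I\to I\star I$, $\theta:J\diamond J\to J$, $\iota:I\to J$, such that $\zeta$ is compatible with the associators of $\diamond$ and of $\star$, $\zeta$ is unital with respect to $\Delta$ and to $\theta$ (on both sides), $(J,\theta,\iota)$ is a monoid in $(\mathsf C,\diamond,I)$ and $(I,\Delta,\iota)$ is a comonoid in $(\mathsf C,\star,J)$. An \emph{$n$-monoidal} structure on $\mathsf C$ consists of $n$ monoidal structures $(\otimes_i,I_i)$, $1\le i\le n$, and a duoidal structure on $(\mathsf C,\otimes_i,\otimes_j)$ for each $i<j$, such that for all $i<j<k$ the functor $\otimes_k:\mathsf C\times\mathsf C\to\mathsf C$ (with structure maps $\zeta_{ik},\Delta_{ik}$ and $\zeta_{jk},\Delta_{jk}$) and the object $I_k$ (with structure maps $\theta_{ik},\iota_{ik}$ and $\theta_{jk},\iota_{jk}$) are compatible with $\zeta_{ij},\Delta_{ij},\theta_{ij},\iota_{ij}$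 in the sense of (1) below. Let $F$ be a functor between duoidal categories. If $F$ carries (lax) monoidal structures $(\varphi,\varphi_0)$ for $\diamond$ and $(\gamma,\gamma_0)$ for $\star$, it is \emph{double monoidal} if $$(1)\quad F\zeta\circ\varphi\circ(\gamma\diamond\gamma)=\gamma\circ(\varphi\star\varphi)\circ\zeta,\quad F\Delta\circ\varphi_0=\gamma\circ(\varphi_0\star\varphi_0)\circ\Delta,\quad F\theta\circ\varphi\circ(\gamma_0\diamond\gamma_0)=\gamma_0\circ\theta,\quad F\iota\circ\varphi_0=\gamma_0\circ\iota .$$ If $F$ is monoidal $(\varphi,\varphi_0)$ for $\diamond$ and comonoidal $(\psi,\psi_0)$ for $\star$, it is \emph{bimonoidal} if $$(2)\quad \psi\circ F\zeta\circ\varphi=(\varphi\star\varphi)\circ\zeta\circ(\psi\diamond\psi),\quad \psi\circ F\Delta\circ\varphi_0=(\varphi_0\star\varphi_0)\circ\Delta,\quad \psi_0\circ F\theta\circ\varphi=\theta\circ(\psi_0\diamond\psi_0),\quad \psi_0\circ F\iota\circ\varphi_0=\iota .$$ If $F$ is comonoidal $(\chi,\chi_0)$ for $\diamond$ and $(\psi,\psi_0)$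 for $\star$, it is \emph{double comonoidal} if $$(3)\quad \zeta\circ(\psi\diamond\psi)\circ\chi=(\chi\star\chi)\circ\psi\circ F\zeta,\quad (\chi_0\star\chi_0)\circ\psi\circ F\Delta=\Delta\circ\chi_0,\quad \theta\circ(\psi_0\diamond\psi_0)\circ\chi=\psi_0\circ F\theta,\quad \psi_0\circ F\iota=\iota\circ\chi_0 .$$ Let $p+q=n$. A \emph{$(p,q)$-monoidal monad} on an $n$-monoidal category is a monad $(\mathcal T,\mu,\eta)$ with a monoidal structure $\gamma_i$ on $\mathcal T$ with respect to $\otimes_i$ for each $i\le p$ and a comonoidal structure $\gamma_i$ with respect to $\otimes_i$ for each $i>p$, such that $\mu$ and $\eta$ are morphisms of monoidal (respectively comonoidal) functors for each of them, and such that for $i<j$ the endofunctor $\mathcal T$ of $(\mathsf C,\otimes_i,\otimes_j)$ is double monoidal if $j\le p$, bimonoidal if $i\le p<j$, and double comonoidal if $p<i$. \textbf{Theorem.} Let $\mathcal T$ be a $(p,q)$-monoidal monad on an $n$-monoidal category $\mathsf C$, $p+q=n$. Assume that $\mathsf C$ has reflexive coequalizers and that these are preserved by $\mathcal T$ and by the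 functor $\otimes_i:\mathsf C\times\mathsf C\to\mathsf C$ for each $i\le p$. Then the category $\mathsf C^{\mathcal T}$ of $\mathcal T$-algebras has an $n$-monoidal structure $$(\mathsf C^{\mathcal T},\otimes^{\gamma_1},\dots,\otimes^{\gamma_p},\otimes_{p+1},\dots,\otimes_n)$$ together with a (lax) monoidal structure on the forgetful functor $\mathcal U:\mathsf C^{\mathcal T}\to\mathsf C$ for each $i$, such that: \begin{itemize} \item for $i\le p$, the unit of $\otimes^{\gamma_i}$ is the free algebra $\mathcal T I_i$, with unit structure map $\eta:I_i\to\mathcal T I_i$ of $\mathcal U$, and for algebras $(V,v)$, $(W,w)$ the structure map $u:V\otimes_i W\to V\otimes^{\gamma_i}W$ of $\mathcal U$ is such that the adjoint algebra morphism $\mathcal T(V\otimes_iW)\to V\otimes^{\gamma_i}W$ is a coequalizer, in $\mathsf C^{\mathcal T}$, of the Linton pair $$\mu\circ\mathcal T\gamma_i,\ \mathcal T(v\otimes_i w):\ \mathcal T(\mathcal T V\otimes_i\mathcal T W)\rightrightarrows\mathcal T(V\otimes_i W);$$ \item for $i>p$, the $i$-th structure on $\mathsf C^{\mathcal T}$ is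 lifted from $\mathsf C$: the tensor product of $(V,v)$ and $(W,w)$ is $V\otimes_iW$ with action $(v\otimes_iw)\circ\gamma_i:\mathcal T(V\otimes_iW)\to V\otimes_iW$, the unit is $I_i$ with action given by the counit $\mathcal T I_i\to I_i$ of $\gamma_i$, and $\mathcal U$ is strict monoidal; \item for $i<j$, the interchange law and the unit maps of $\mathsf C^{\mathcal T}$ are induced by those of $\mathsf C$: $\mathcal U$ is a double monoidal functor $(\mathsf C^{\mathcal T},i,j)\to(\mathsf C,\otimes_i,\otimes_j)$ for the above structures. \end{itemize} -/

import Mathlib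

open CategoryTheory CategoryTheory.Limits

universe v v' u u'

namespace HigherMonoidal

/- Several monoidal structures live on the same category, so monoidal structures are passed
explicitly: `A ⊠[M] B` is the tensor product of objects, `f ⊠ₘ[M] g` that of morphisms, with
respect to the monoidal structure `M`. -/

notation:70 A:71 " ⊠[" M "]" B:70 => (MonoidalCategoryStruct.tensorObj
  (self := MonoidalCategory.toMonoidalCategoryStruct (self := M)) A B)

notation:70 f:71 " ⊠ₘ[" M "]" g:70 => (MonoidalCategoryStruct.tensorHom
  (self := MonoidalCategory.toMonoidalCategoryStruct (self := M)) f g)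

section Categories

variable {C : Type u} [Category.{v} C]

/-- The structure making `(C, M, N)` a duoidal (2-monoidal) category, where `M = (⋄, I)` and
`N = (⋆, J)`: an interchange law and three unit maps. -/
structure DuoidalStr (M N : MonoidalCategory C) where
  /-- the interchange law `(A ⋆ B) ⋄ (C ⋆ D) ⟶ (A ⋄ C) ⋆ (B ⋄ D)` -/
  ζ : ∀ A B X Y : C, (A ⊠[N] B) ⊠[M] (X ⊠[N] Y) ⟶ (A ⊠[M] X) ⊠[N] (B ⊠[M] Y)
  /-- the unit map `I ⟶ I ⋆ I` -/
  Δ : M.tensorUnit ⟶ M.tensorUnit ⊠[N] M.tensorUnit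
  /-- the unit map `J ⋄ J ⟶ J` -/
  θ : N.tensorUnit ⊠[M] N.tensorUnit ⟶ N.tensorUnit
  /-- the unit map `I ⟶ J` -/
  ι : M.tensorUnit ⟶ N.tensorUnit
  ζ_natural : ∀ {A A' B B' X X' Y Y' : C} (f : A ⟶ A') (g : B ⟶ B') (h : X ⟶ X') (k : Y ⟶ Y'),
    ((f ⊠ₘ[N] g) ⊠ₘ[M] (h ⊠ₘ[N] k)) ≫ ζ A' B' X' Y' =
      ζ A B X Y ≫ ((f ⊠ₘ[M] h) ⊠ₘ[N] (g ⊠ₘ[M] k))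
  /-- compatibility of the interchange law with the associator of `⋄` -/
  ζ_assoc_left : ∀ A B X Y E F : C,
    (ζ A B X Y ⊠ₘ[M] 𝟙 (E ⊠[N] F)) ≫ ζ (A ⊠[M] X) (B ⊠[M] Y) E F ≫
        ((M.associator A X E).hom ⊠ₘ[N] (M.associator B Y F).hom) =
      (M.associator (A ⊠[N] B) (X ⊠[N] Y) (E ⊠[N] F)).hom ≫
        (𝟙 (A ⊠[N] B) ⊠ₘ[M] ζ X Y E F) ≫ ζ A B (X ⊠[M] E) (Y ⊠[M] F)
  /-- compatibility of the interchange law with the associator of `⋆` -/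
  ζ_assoc_right : ∀ A B X Y E F : C,
    ζ (A ⊠[N] B) X (Y ⊠[N] E) F ≫ (ζ A B Y E ⊠ₘ[N] 𝟙 (X ⊠[M] F)) ≫
        (N.associator (A ⊠[M] Y) (B ⊠[M] E) (X ⊠[M] F)).hom =
      ((N.associator A B X).hom ⊠ₘ[M] (N.associator Y E F).hom) ≫
        ζ A (B ⊠[N] X) Y (E ⊠[N] F) ≫ (𝟙 (A ⊠[M] Y) ⊠ₘ[N] ζ B X E F)
  Δ_left_unit : ∀ A B : C,
    (Δ ⊠ₘ[M] 𝟙 (A ⊠[N] B)) ≫ ζ M.tensorUnit M.tensorUnit A B ≫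
        ((M.leftUnitor A).hom ⊠ₘ[N] (M.leftUnitor B).hom) =
      (M.leftUnitor (A ⊠[N] B)).hom
  Δ_right_unit : ∀ A B : C,
    (𝟙 (A ⊠[N] B) ⊠ₘ[M] Δ) ≫ ζ A B M.tensorUnit M.tensorUnit ≫
        ((M.rightUnitor A).hom ⊠ₘ[N] (M.rightUnitor B).hom) =
      (M.rightUnitor (A ⊠[N] B)).hom
  θ_left_unit : ∀ A B : C,
    ζ N.tensorUnit A N.tensorUnit B ≫ (θ ⊠ₘ[N] 𝟙 (A ⊠[M] B)) ≫ (N.leftUnitor (A ⊠[M] B)).hom =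
      (N.leftUnitor A).hom ⊠ₘ[M] (N.leftUnitor B).hom
  θ_right_unit : ∀ A B : C,
    ζ A N.tensorUnit B N.tensorUnit ≫ (𝟙 (A ⊠[M] B) ⊠ₘ[N] θ) ≫ (N.rightUnitor (A ⊠[M] B)).hom =
      (N.rightUnitor A).hom ⊠ₘ[M] (N.rightUnitor B).hom
  /-- `(J, θ, ι)` is a monoid in `(C, ⋄, I)` -/
  monoid_one_mul : (ι ⊠ₘ[M] 𝟙 N.tensorUnit) ≫ θ = (M.leftUnitor N.tensorUnit).hom
  monoid_mul_one : (𝟙 N.tensorUnit ⊠ₘ[M] ι) ≫ θ = (M.rightUnitor N.tensorUnit).hom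
  monoid_assoc : (θ ⊠ₘ[M] 𝟙 N.tensorUnit) ≫ θ =
    (M.associator N.tensorUnit N.tensorUnit N.tensorUnit).hom ≫ (𝟙 N.tensorUnit ⊠ₘ[M] θ) ≫ θ
  /-- `(I, Δ, ι)` is a comonoid in `(C, ⋆, J)` -/
  comonoid_counit_comul : Δ ≫ (ι ⊠ₘ[N] 𝟙 M.tensorUnit) = (N.leftUnitor M.tensorUnit).inv
  comonoid_comul_counit : Δ ≫ (𝟙 M.tensorUnit ⊠ₘ[N] ι) = (N.rightUnitor M.tensorUnit).inv
  comonoid_coassoc : Δ ≫ (Δ ⊠ₘ[N] 𝟙 M.tensorUnit) ≫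
      (N.associator M.tensorUnit M.tensorUnit M.tensorUnit).hom =
    Δ ≫ (𝟙 M.tensorUnit ⊠ₘ[N] Δ)

/-- The remaining axioms of a 3-monoidal category `(C, M, N, P)`, with `M = (⋄, I)`,
`N = (⊗, J)`, `P = (⋆, K)`, given the three duoidal structures. They say that
`⋆ : C × C ⥤ C` and `K : 1 ⥤ C` are double (lax) monoidal functors with respect to `⋄`, `⊗`. -/
structure IsTrioidal {M N P : MonoidalCategory C}
    (S₁₂ : DuoidalStr M N) (S₁₃ : DuoidalStr M P) (S₂₃ : DuoidalStr N P) : Prop where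
  /-- the hexagon of interchange laws -/
  interchange : ∀ A₁ B₁ A₂ B₂ C₁ D₁ C₂ D₂ : C,
    S₁₂.ζ (A₁ ⊠[P] B₁) (A₂ ⊠[P] B₂) (C₁ ⊠[P] D₁) (C₂ ⊠[P] D₂) ≫
        (S₁₃.ζ A₁ B₁ C₁ D₁ ⊠ₘ[N] S₁₃.ζ A₂ B₂ C₂ D₂) ≫
        S₂₃.ζ (A₁ ⊠[M] C₁) (B₁ ⊠[M] D₁) (A₂ ⊠[M] C₂) (B₂ ⊠[M] D₂) =
      (S₂₃.ζ A₁ B₁ A₂ B₂ ⊠ₘ[M] S₂₃.ζ C₁ D₁ C₂ D₂) ≫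
        S₁₃.ζ (A₁ ⊠[N] A₂) (B₁ ⊠[N] B₂) (C₁ ⊠[N] C₂) (D₁ ⊠[N] D₂) ≫
        (S₁₂.ζ A₁ A₂ C₁ C₂ ⊠ₘ[P] S₁₂.ζ B₁ B₂ D₁ D₂)
  /-- `I ⟶ (I ⊗ I) ⋆ (I ⊗ I)` -/
  unit_first : S₁₂.Δ ≫ (S₁₃.Δ ⊠ₘ[N] S₁₃.Δ) ≫
      S₂₃.ζ M.tensorUnit M.tensorUnit M.tensorUnit M.tensorUnit =
    S₁₃.Δ ≫ (S₁₂.Δ ⊠ₘ[P] S₁₂.Δ)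
  /-- `J ⋄ J ⟶ J ⋆ J` -/
  unit_second : S₁₂.θ ≫ S₂₃.Δ =
    (S₂₃.Δ ⊠ₘ[M] S₂₃.Δ) ≫ S₁₃.ζ N.tensorUnit N.tensorUnit N.tensorUnit N.tensorUnit ≫
      (S₁₂.θ ⊠ₘ[P] S₁₂.θ)
  /-- `(K ⊗ K) ⋄ (K ⊗ K) ⟶ K` -/
  unit_third : (S₂₃.θ ⊠ₘ[M] S₂₃.θ) ≫ S₁₃.θ =
    S₁₂.ζ P.tensorUnit P.tensorUnit P.tensorUnit P.tensorUnit ≫ (S₁₃.θ ⊠ₘ[N] S₁₃.θ) ≫ S₂₃.θ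
  /-- `I ⟶ J ⋆ J` -/
  unit_first_second : S₁₂.ι ≫ S₂₃.Δ = S₁₃.Δ ≫ (S₁₂.ι ⊠ₘ[P] S₁₂.ι)
  /-- `I ⟶ K`, through `K ⊗ K` -/
  unit_first_third : S₁₂.Δ ≫ (S₁₃.ι ⊠ₘ[N] S₁₃.ι) ≫ S₂₃.θ = S₁₃.ι
  /-- `J ⋄ J ⟶ K` -/
  unit_second_third : S₁₂.θ ≫ S₂₃.ι = (S₂₃.ι ⊠ₘ[M] S₂₃.ι) ≫ S₁₃.θ
  /-- `I ⟶ K`, through `J` -/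
  unit_triangle : S₁₂.ι ≫ S₂₃.ι = S₁₃.ι

variable (C) in
/-- An `n`-monoidal structure on a category. (Structures are numbered `0, …, n - 1`.) -/
structure NMonoidalStr (n : ℕ) where
  /-- the `n` monoidal structures -/
  mon : Fin n → MonoidalCategory C
  /-- the interchange laws and the unit maps -/
  duo : ∀ i j : Fin n, i < j → DuoidalStr (mon i) (mon j)
  tri : ∀ (i j k : Fin n) (hij : i < j) (hjk : j < k),
    IsTrioidal (duo i j hij) (duo i k (hij.trans hjk)) (duo j k hjk)

end Categories

section Functors

variable {C : Type u} [Category.{v} C] {D : Type u'} [Category.{v'} D]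

/-- A (lax) monoidal structure on a functor. -/
abbrev LaxStr (M : MonoidalCategory C) (M' : MonoidalCategory D) (F : C ⥤ D) :=
  F.LaxMonoidal

/-- A comonoidal (oplax monoidal) structure on a functor. -/
abbrev ColaxStr (M : MonoidalCategory C) (M' : MonoidalCategory D) (F : C ⥤ D) :=
  F.OplaxMonoidal

section

variable {M : MonoidalCategory C} {M' : MonoidalCategory D} {F : C ⥤ D}

/-- The map `φ₀ : I ⟶ F I`. -/
abbrev LaxStr.φ₀ (L : LaxStr M M' F) : M'.tensorUnit ⟶ F.obj M.tensorUnit :=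
  L.ε

/-- The map `φ : F A ⊗ F B ⟶ F (A ⊗ B)`. -/
abbrev LaxStr.φ (L : LaxStr M M' F) (A B : C) : F.obj A ⊠[M'] F.obj B ⟶ F.obj (A ⊠[M] B) :=
  L.μ A B

/-- The map `ψ₀ : F I ⟶ I`. -/
abbrev ColaxStr.ψ₀ (K : ColaxStr M M' F) : F.obj M.tensorUnit ⟶ M'.tensorUnit :=
  K.η

/-- The map `ψ : F (A ⊗ B) ⟶ F A ⊗ F B`. -/
abbrev ColaxStr.ψ (K : ColaxStr M M' F) (A B : C) : F.obj (A ⊠[M] B) ⟶ F.obj A ⊠[M'] F.obj B :=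
  K.δ A B

end

variable {M N : MonoidalCategory C} {M' N' : MonoidalCategory D} {F : C ⥤ D}

/-- Compatibility making a functor between duoidal categories, monoidal for both structures, a
double monoidal functor. -/
structure IsDoubleLax (S : DuoidalStr M N) (S' : DuoidalStr M' N')
    (φ : LaxStr M M' F) (γ : LaxStr N N' F) : Prop where
  interchange : ∀ A B X Y : C,
    (γ.φ A B ⊠ₘ[M'] γ.φ X Y) ≫ φ.φ (A ⊠[N] B) (X ⊠[N] Y) ≫ F.map (S.ζ A B X Y) =
      S'.ζ (F.obj A) (F.obj B) (F.obj X) (F.obj Y) ≫ (φ.φ A X ⊠ₘ[N'] φ.φ B Y) ≫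
        γ.φ (A ⊠[M] X) (B ⊠[M] Y)
  unit_first : φ.φ₀ ≫ F.map S.Δ = S'.Δ ≫ (φ.φ₀ ⊠ₘ[N'] φ.φ₀) ≫ γ.φ M.tensorUnit M.tensorUnit
  unit_second : (γ.φ₀ ⊠ₘ[M'] γ.φ₀) ≫ φ.φ N.tensorUnit N.tensorUnit ≫ F.map S.θ = S'.θ ≫ γ.φ₀
  unit_unit : φ.φ₀ ≫ F.map S.ι = S'.ι ≫ γ.φ₀

/-- Compatibility making a functor between duoidal categories, monoidal for the first and
comonoidal for the second structure, a bimonoidal (bilax) functor. -/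
structure IsBilax (S : DuoidalStr M N) (S' : DuoidalStr M' N')
    (φ : LaxStr M M' F) (ψ : ColaxStr N N' F) : Prop where
  interchange : ∀ A B X Y : C,
    φ.φ (A ⊠[N] B) (X ⊠[N] Y) ≫ F.map (S.ζ A B X Y) ≫ ψ.ψ (A ⊠[M] X) (B ⊠[M] Y) =
      (ψ.ψ A B ⊠ₘ[M'] ψ.ψ X Y) ≫ S'.ζ (F.obj A) (F.obj B) (F.obj X) (F.obj Y) ≫
        (φ.φ A X ⊠ₘ[N'] φ.φ B Y)
  unit_first : φ.φ₀ ≫ F.map S.Δ ≫ ψ.ψ M.tensorUnit M.tensorUnit = S'.Δ ≫ (φ.φ₀ ⊠ₘ[N'] φ.φ₀)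
  unit_second : φ.φ N.tensorUnit N.tensorUnit ≫ F.map S.θ ≫ ψ.ψ₀ = (ψ.ψ₀ ⊠ₘ[M'] ψ.ψ₀) ≫ S'.θ
  unit_unit : φ.φ₀ ≫ F.map S.ι ≫ ψ.ψ₀ = S'.ι

/-- Compatibility making a functor between duoidal categories, comonoidal for both structures, a
double comonoidal functor. -/
structure IsDoubleColax (S : DuoidalStr M N) (S' : DuoidalStr M' N')
    (χ : ColaxStr M M' F) (ψ : ColaxStr N N' F) : Prop where
  interchange : ∀ A B X Y : C,
    χ.ψ (A ⊠[N] B) (X ⊠[N] Y) ≫ (ψ.ψ A B ⊠ₘ[M'] ψ.ψ X Y) ≫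
        S'.ζ (F.obj A) (F.obj B) (F.obj X) (F.obj Y) =
      F.map (S.ζ A B X Y) ≫ ψ.ψ (A ⊠[M] X) (B ⊠[M] Y) ≫ (χ.ψ A X ⊠ₘ[N'] χ.ψ B Y)
  unit_first : F.map S.Δ ≫ ψ.ψ M.tensorUnit M.tensorUnit ≫ (χ.ψ₀ ⊠ₘ[N'] χ.ψ₀) = χ.ψ₀ ≫ S'.Δ
  unit_second : χ.ψ N.tensorUnit N.tensorUnit ≫ (ψ.ψ₀ ⊠ₘ[M'] ψ.ψ₀) ≫ S'.θ = F.map S.θ ≫ ψ.ψ₀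
  unit_unit : F.map S.ι ≫ ψ.ψ₀ = χ.ψ₀ ≫ S'.ι

end Functors

section Monads

variable {C : Type u} [Category.{v} C]

/-- A monoidal structure on a monad: a monoidal structure on the endofunctor for which the unit
and the multiplication are morphisms of monoidal functors. -/
structure LaxMonadStr (M : MonoidalCategory C) (T : Monad C) where
  lax : LaxStr M M T.toFunctor
  unit_isMonoidal : NatTrans.IsMonoidal T.η
  mul_isMonoidal : NatTrans.IsMonoidal T.μ

/-- A comonoidal structure on a monad: a comonoidal structure on the endofunctor for which the
unit and the multiplication are morphisms of comonoidal functors. -/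
structure ColaxMonadStr (M : MonoidalCategory C) (T : Monad C) where
  colax : ColaxStr M M T.toFunctor
  unit_counit : T.η.app M.tensorUnit ≫ colax.ψ₀ = 𝟙 M.tensorUnit
  unit_tensor : ∀ A B : C, T.η.app (A ⊠[M] B) ≫ colax.ψ A B = T.η.app A ⊠ₘ[M] T.η.app B
  mul_counit : T.μ.app M.tensorUnit ≫ colax.ψ₀ = T.map colax.ψ₀ ≫ colax.ψ₀
  mul_tensor : ∀ A B : C, T.μ.app (A ⊠[M] B) ≫ colax.ψ A B =
    T.map (colax.ψ A B) ≫ colax.ψ (T.obj A) (T.obj B) ≫ (T.μ.app A ⊠ₘ[M] T.μ.app B)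

/-- A `(p, n - p)`-monoidal structure on a monad on an `n`-monoidal category: the first `p`
structures are monoidal and the remaining ones comonoidal, with pairwise compatibilities. -/
structure PQMonadStr {n : ℕ} (S : NMonoidalStr C n) (p : ℕ) (T : Monad C) where
  lax : ∀ i : Fin n, i.val < p → LaxMonadStr (S.mon i) T
  colax : ∀ i : Fin n, p ≤ i.val → ColaxMonadStr (S.mon i) T
  isDoubleLax : ∀ (i j : Fin n) (hij : i < j) (hi : i.val < p) (hj : j.val < p),
    IsDoubleLax (S.duo i j hij) (S.duo i j hij) (lax i hi).lax (lax j hj).lax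
  isBilax : ∀ (i j : Fin n) (hij : i < j) (hi : i.val < p) (hj : p ≤ j.val),
    IsBilax (S.duo i j hij) (S.duo i j hij) (lax i hi).lax (colax j hj).colax
  isDoubleColax : ∀ (i j : Fin n) (hij : i < j) (hi : p ≤ i.val) (hj : p ≤ j.val),
    IsDoubleColax (S.duo i j hij) (S.duo i j hij) (colax i hi).colax (colax j hj).colax

variable {T : Monad C}

/-- The morphism of algebras `free X ⟶ W` adjoint to `f : X ⟶ W`. -/
def extend {X : C} {W : T.Algebra} (f : X ⟶ W.A) : T.free.obj X ⟶ W :=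
  (T.adj.homEquiv X W).symm f

section Linton

variable {M : MonoidalCategory C}

/-- `μ ∘ T φ : T (T V ⊗ T W) ⟶ T (V ⊗ W)`, the first arrow of the Linton pair of `V` and `W`. -/
def lintonFst (γ : LaxMonadStr M T) (V W : T.Algebra) :
    T.free.obj (T.obj V.A ⊠[M] T.obj W.A) ⟶ T.free.obj (V.A ⊠[M] W.A) where
  f := T.map (γ.lax.φ V.A W.A) ≫ T.μ.app (V.A ⊠[M] W.A)
  h := by
    have h₁ : T.map (T.map (γ.lax.φ V.A W.A)) ≫ T.μ.app (T.obj (V.A ⊠[M] W.A)) =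
        T.μ.app (T.obj V.A ⊠[M] T.obj W.A) ≫ T.map (γ.lax.φ V.A W.A) :=
      T.μ.naturality _
    have h₂ := T.assoc (V.A ⊠[M] W.A)
    simp only [Monad.free, Functor.map_comp, Category.assoc]
    rw [h₂, reassoc_of% h₁]

/-- `T (v ⊗ w) : T (T V ⊗ T W) ⟶ T (V ⊗ W)`, the second arrow of the Linton pair of `V`, `W`. -/
def lintonSnd (M : MonoidalCategory C) (V W : T.Algebra) :
    T.free.obj (T.obj V.A ⊠[M] T.obj W.A) ⟶ T.free.obj (V.A ⊠[M] W.A) :=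
  T.free.map (V.a ⊠ₘ[M] W.a)

/-- Let `u` be a monoidal structure on the forgetful functor `(Algebra T, M') ⥤ (C, M)`.
The monoidal structure `M'` on algebras is a Linton tensor product, with universal bilinear maps
`u.φ V W : V ⊗ W ⟶ V ⊗' W`: the unit is the free algebra on the unit of `M`, and `V ⊗' W` is the
coequalizer, in the category of algebras, of the Linton pair of `V` and `W`. -/
structure IsLintonTensor (γ : LaxMonadStr M T) {M' : MonoidalCategory T.Algebra}
    (u : LaxStr M' M T.forget) : Prop where
  unit : ∃ h : M'.tensorUnit = T.free.obj M.tensorUnit,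
    u.φ₀ = T.η.app M.tensorUnit ≫ eqToHom (congrArg Monad.Algebra.A h.symm)
  coequalizer : ∀ V W : T.Algebra,
    ∃ w : lintonFst γ V W ≫ extend (W := V ⊠[M'] W) (u.φ V W) =
        lintonSnd M V W ≫ extend (W := V ⊠[M'] W) (u.φ V W),
      Nonempty (IsColimit (Cofork.ofπ (extend (W := V ⊠[M'] W) (u.φ V W)) w))

end Linton

section Lift

variable {M : MonoidalCategory C}

/-- The algebra `V ⊗ W` with action `T (V ⊗ W) ⟶ T V ⊗ T W ⟶ V ⊗ W`. -/
def tensorAlgebra (γ : ColaxMonadStr M T) (V W : T.Algebra) : T.Algebra where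
  A := V.A ⊠[M] W.A
  a := γ.colax.ψ V.A W.A ≫ (V.a ⊠ₘ[M] W.a)
  unit := by
    rw [← Category.assoc, γ.unit_tensor, MonoidalCategory.tensorHom_comp_tensorHom, V.unit, W.unit]
    exact MonoidalCategory.id_tensorHom_id V.A W.A
  assoc := by
    have h : γ.colax.ψ (T.obj V.A) (T.obj W.A) ≫ (T.map V.a ⊠ₘ[M] T.map W.a) =
        T.map (V.a ⊠ₘ[M] W.a) ≫ γ.colax.ψ V.A W.A :=
      letI := γ.colax
      Functor.OplaxMonoidal.δ_natural T.toFunctor V.a W.a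
    rw [← Category.assoc, γ.mul_tensor, Functor.map_comp]
    simp only [Category.assoc, MonoidalCategory.tensorHom_comp_tensorHom, V.assoc, W.assoc]
    rw [← MonoidalCategory.tensorHom_comp_tensorHom, reassoc_of% h]

/-- The unit object with action `T I ⟶ I`. -/
def unitAlgebra (γ : ColaxMonadStr M T) : T.Algebra where
  A := M.tensorUnit
  a := γ.colax.ψ₀
  unit := γ.unit_counit
  assoc := γ.mul_counit

/-- Let `u` be a monoidal structure on the forgetful functor `(Algebra T, M') ⥤ (C, M)`.
The monoidal structure `M'` on algebras is the lift of `M` along the comonoidal structure of the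
monad: tensor products and unit are those of `M` with the canonical actions, and the forgetful
functor is strict monoidal. -/
structure IsLiftedTensor (γ : ColaxMonadStr M T) {M' : MonoidalCategory T.Algebra}
    (u : LaxStr M' M T.forget) : Prop where
  unit : ∃ h : M'.tensorUnit = unitAlgebra γ,
    u.φ₀ = eqToHom (congrArg Monad.Algebra.A h.symm)
  tensor : ∀ V W : T.Algebra, ∃ h : V ⊠[M'] W = tensorAlgebra γ V W,
    u.φ V W = eqToHom (congrArg Monad.Algebra.A h.symm)

end Lift

end Monads

end HigherMonoidal

open HigherMonoidal

/-! The Linton product of two algebras classifies bilinear maps, so a morphism out of it is known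
from its restriction to the tensor product of underlying objects. Each structure map on algebras is
therefore obtained by extending the structure map of `C`, and each axiom should follow from the same
axiom in `C`. `Covers` expresses that an algebra morphism extends a given map of `C`. It is stable
under composition, tensor products and coherence maps, and `Generates.eq` transfers equations,
provided that the canonical maps from iterated tensor products in `C` to iterated tensor products of
algebras determine algebra morphisms.

For Linton products this proviso comes from presentations. `Presents` describes an algebra by
generators and a reflexive family of relations. Since `T` and the first `p` tensor products preserve
reflexive coequalizers, `Presents.tens` shows that generators and relations of two algebras,
tensored together, present their Linton product. Iterated Linton products are thus presented by
tensor products in `C`, which yields both uniqueness and existence of the required morphisms.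

For lifted structures nothing is assumed about coequalizers, and presented maps need not be stable
under the tensor product. There the generating class consists of isomorphisms only. Isomorphisms are
presented, so the class can only grow as the index decreases. This is the right direction: in the
sources of the axioms the structure of smaller index is outermost.

The interchange laws exist because conditions (1), (2) and (3) make the maps `ζ` of `C` compatible
with the relations; in the three cases this is `nonempty_duoidalLift_of_isDoubleLax`,
`nonempty_duoidalLift_of_isBilax` and `nonempty_duoidalLift_of_isDoubleColax`. -/

namespace HigherMonoidal

/-! ### Functoriality of an explicitly given tensor product. -/

section TensorHom

variable {C : Type u} [Category.{v} C] (M : MonoidalCategory C)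

theorem tens_comp {X₁ Y₁ Z₁ X₂ Y₂ Z₂ : C} (f₁ : X₁ ⟶ Y₁) (f₂ : X₂ ⟶ Y₂) (g₁ : Y₁ ⟶ Z₁)
    (g₂ : Y₂ ⟶ Z₂) : (f₁ ⊠ₘ[M] f₂) ≫ (g₁ ⊠ₘ[M] g₂) = (f₁ ≫ g₁) ⊠ₘ[M] (f₂ ≫ g₂) :=
  MonoidalCategory.tensorHom_comp_tensorHom _ _ _ _

theorem tens_comp_assoc {X₁ Y₁ Z₁ X₂ Y₂ Z₂ W : C} (f₁ : X₁ ⟶ Y₁) (f₂ : X₂ ⟶ Y₂) (g₁ : Y₁ ⟶ Z₁)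
    (g₂ : Y₂ ⟶ Z₂) (h : Z₁ ⊠[M] Z₂ ⟶ W) :
    (f₁ ⊠ₘ[M] f₂) ≫ (g₁ ⊠ₘ[M] g₂) ≫ h = ((f₁ ≫ g₁) ⊠ₘ[M] (f₂ ≫ g₂)) ≫ h := by
  rw [← Category.assoc, tens_comp]

theorem tens_id (X Y : C) : (𝟙 X) ⊠ₘ[M] (𝟙 Y) = 𝟙 (X ⊠[M] Y) :=
  MonoidalCategory.id_tensorHom_id _ _

end TensorHom

/-! ### Reflecting a monoidal structure along a functor. -/

section Covers

variable {C : Type u} [Category.{v} C] {D : Type u'} [Category.{v'} D] {U : D ⥤ C}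

/-- The morphism `k` lies over `m` along the maps `κ` and `κ'`. -/
def Covers {X Y : C} {A B : D} (κ : X ⟶ U.obj A) (κ' : Y ⟶ U.obj B) (m : X ⟶ Y) (k : A ⟶ B) :
    Prop :=
  κ ≫ U.map k = m ≫ κ'

theorem Covers.id {X : C} {A : D} (κ : X ⟶ U.obj A) : Covers κ κ (𝟙 X) (𝟙 A) := by
  simp [Covers]

theorem Covers.map {A B : D} (k : A ⟶ B) :
    Covers (𝟙 (U.obj A)) (𝟙 (U.obj B)) (U.map k) k := by
  simp [Covers]

theorem Covers.comp {X Y Z : C} {A B E : D} {κ : X ⟶ U.obj A} {κ' : Y ⟶ U.obj B}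
    {κ'' : Z ⟶ U.obj E} {m : X ⟶ Y} {m' : Y ⟶ Z} {k : A ⟶ B} {k' : B ⟶ E}
    (h : Covers κ κ' m k) (h' : Covers κ' κ'' m' k') : Covers κ κ'' (m ≫ m') (k ≫ k') := by
  unfold Covers at *
  rw [Functor.map_comp, ← Category.assoc, h, Category.assoc, h', Category.assoc]

/-- Needed for the counit axioms of a duoidal structure, which involve inverse unitors. -/
theorem Covers.inv {X Y : C} {A B : D} {κ : X ⟶ U.obj A} {κ' : Y ⟶ U.obj B}
    {m : X ≅ Y} {k : A ≅ B} (h : Covers κ κ' m.hom k.hom) : Covers κ' κ m.inv k.inv := by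
  unfold Covers at *
  rw [Iso.eq_inv_comp, ← Category.assoc, ← h, Category.assoc, ← U.map_comp, k.hom_inv_id,
    U.map_id, Category.comp_id]

/-- The data of a lax monoidal structure on `U`, on a category which is not yet known to be
monoidal. -/
structure LaxData (S : MonoidalCategoryStruct D) (M : MonoidalCategory C) (U : D ⥤ C) where
  one : M.tensorUnit ⟶ U.obj S.tensorUnit
  ten : ∀ A B : D, U.obj A ⊠[M] U.obj B ⟶ U.obj (S.tensorObj A B)
  natural : ∀ {A A' B B' : D} (f : A ⟶ A') (g : B ⟶ B'),
    ten A B ≫ U.map (S.tensorHom f g) = (U.map f ⊠ₘ[M] U.map g) ≫ ten A' B'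
  assoc : ∀ A B E : D,
    Covers ((ten A B ⊠ₘ[M] 𝟙 (U.obj E)) ≫ ten (S.tensorObj A B) E)
      ((𝟙 (U.obj A) ⊠ₘ[M] ten B E) ≫ ten A (S.tensorObj B E))
      (M.associator (U.obj A) (U.obj B) (U.obj E)).hom (S.associator A B E).hom
  left : ∀ A : D, Covers ((one ⊠ₘ[M] 𝟙 (U.obj A)) ≫ ten S.tensorUnit A) (𝟙 (U.obj A))
    (M.leftUnitor (U.obj A)).hom (S.leftUnitor A).hom
  right : ∀ A : D, Covers ((𝟙 (U.obj A) ⊠ₘ[M] one) ≫ ten A S.tensorUnit) (𝟙 (U.obj A))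
    (M.rightUnitor (U.obj A)).hom (S.rightUnitor A).hom

/-- A lax monoidal structure on `U` as lax monoidal data. -/
abbrev LaxStr.data {M' : MonoidalCategory D} {M : MonoidalCategory C} (L : LaxStr M' M U) :
    LaxData M'.toMonoidalCategoryStruct M U where
  one := L.φ₀
  ten := L.φ
  natural f g := (letI := L; Functor.LaxMonoidal.μ_natural U f g).symm
  assoc A B E := by
    let := L
    simp [Covers]
  left A := by
    let := L
    simp [Covers]
  right A := by
    let := L
    simp [Covers]

section

variable {S : MonoidalCategoryStruct D} {M : MonoidalCategory C} (L : LaxData S M U)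

/-- The canonical map on a tensor product induced by maps on the factors. -/
abbrev LaxData.tens {X Y : C} {A B : D} (κ : X ⟶ U.obj A) (κ' : Y ⟶ U.obj B) :
    X ⊠[M] Y ⟶ U.obj (S.tensorObj A B) :=
  (κ ⊠ₘ[M] κ') ≫ L.ten A B

/-- Together with the analogues for associators and unitors, this makes any formal composite of
structure maps of `D` cover the same composite in `C`. -/
theorem LaxData.covers_tensor {X Y X' Y' : C} {A B A' B' : D} {κ : X ⟶ U.obj A}
    {κ' : X' ⟶ U.obj A'} {l : Y ⟶ U.obj B} {l' : Y' ⟶ U.obj B'} {m : X ⟶ X'} {k : A ⟶ A'}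
    {n : Y ⟶ Y'} {j : B ⟶ B'} (h : Covers κ κ' m k) (h' : Covers l l' n j) :
    Covers (L.tens κ l) (L.tens κ' l') (m ⊠ₘ[M] n) (S.tensorHom k j) := by
  unfold Covers at *
  rw [Category.assoc, L.natural, ← Category.assoc, ← Category.assoc,
    MonoidalCategory.tensorHom_comp_tensorHom, MonoidalCategory.tensorHom_comp_tensorHom, h, h']

theorem LaxData.covers_assoc {X Y Z : C} {A B E : D} (κ : X ⟶ U.obj A) (l : Y ⟶ U.obj B)
    (o : Z ⟶ U.obj E) :
    Covers (L.tens (L.tens κ l) o) (L.tens κ (L.tens l o)) (M.associator X Y Z).hom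
      (S.associator A B E).hom := by
  have h := L.assoc A B E
  let := M
  have h₁ : L.tens (L.tens κ l) o = ((κ ⊠ₘ[M] l) ⊠ₘ[M] o) ≫
      ((L.ten A B ⊠ₘ[M] 𝟙 (U.obj E)) ≫ L.ten (S.tensorObj A B) E) := by
    simp only [LaxData.tens, ← Category.assoc, MonoidalCategory.tensorHom_comp_tensorHom,
      Category.comp_id]
  have h₂ : L.tens κ (L.tens l o) = (κ ⊠ₘ[M] (l ⊠ₘ[M] o)) ≫
      ((𝟙 (U.obj A) ⊠ₘ[M] L.ten B E) ≫ L.ten A (S.tensorObj B E)) := by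
    simp only [LaxData.tens, ← Category.assoc, MonoidalCategory.tensorHom_comp_tensorHom,
      Category.comp_id]
  unfold Covers at *
  rw [h₁, Category.assoc, h, h₂, ← Category.assoc, ← Category.assoc,
    MonoidalCategory.associator_naturality]
  simp only [Category.assoc]

theorem LaxData.covers_left {X : C} {A : D} (κ : X ⟶ U.obj A) :
    Covers (L.tens L.one κ) κ (M.leftUnitor X).hom (S.leftUnitor A).hom := by
  have h := L.left A
  let := M
  have h₁ : L.tens L.one κ = (𝟙 M.tensorUnit ⊠ₘ[M] κ) ≫
      (L.one ⊠ₘ[M] 𝟙 (U.obj A)) ≫ L.ten S.tensorUnit A := by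
    simp only [LaxData.tens, ← Category.assoc, MonoidalCategory.tensorHom_comp_tensorHom,
      Category.comp_id, Category.id_comp]
  unfold Covers at *
  rw [h₁, Category.assoc, h, MonoidalCategory.id_tensorHom, Category.comp_id]
  exact MonoidalCategory.leftUnitor_naturality κ

theorem LaxData.covers_right {X : C} {A : D} (κ : X ⟶ U.obj A) :
    Covers (L.tens κ L.one) κ (M.rightUnitor X).hom (S.rightUnitor A).hom := by
  have h := L.right A
  let := M
  have h₁ : L.tens κ L.one = (κ ⊠ₘ[M] 𝟙 M.tensorUnit) ≫
      (𝟙 (U.obj A) ⊠ₘ[M] L.one) ≫ L.ten A S.tensorUnit := by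
    simp only [LaxData.tens, ← Category.assoc, MonoidalCategory.tensorHom_comp_tensorHom,
      Category.comp_id, Category.id_comp]
  unfold Covers at *
  rw [h₁, Category.assoc, h, MonoidalCategory.tensorHom_id, Category.comp_id]
  exact MonoidalCategory.rightUnitor_naturality κ

end

/-- A class of maps from objects of the base to underlying objects. -/
abbrev MapClass (U : D ⥤ C) : Type _ := ∀ ⦃X : C⦄ ⦃A : D⦄, (X ⟶ U.obj A) → Prop

/-- Morphisms are determined by their composites with the maps of the class `Q`, which contains
identities and is closed under the operations of lax monoidal data. -/
structure Generates {S : MonoidalCategoryStruct D} {M : MonoidalCategory C} (Q : MapClass U)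
    (L : LaxData S M U) : Prop where
  ext : ∀ {X : C} {A B : D} {κ : X ⟶ U.obj A}, Q κ → ∀ {k k' : A ⟶ B},
    κ ≫ U.map k = κ ≫ U.map k' → k = k'
  id : ∀ A : D, Q (𝟙 (U.obj A))
  tens : ∀ {X Y : C} {A B : D} {κ : X ⟶ U.obj A} {l : Y ⟶ U.obj B}, Q κ → Q l → Q (L.tens κ l)
  one : Q L.one

/-- The transfer principle: two morphisms agree once they cover equal maps along a generating source
map. No condition on the target map is needed. -/
theorem Generates.eq {S : MonoidalCategoryStruct D} {M : MonoidalCategory C} {Q : MapClass U}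
    {L : LaxData S M U} (G : Generates Q L) {X Y : C} {A B : D} {κ : X ⟶ U.obj A}
    {κ' : Y ⟶ U.obj B} {m m' : X ⟶ Y} {k k' : A ⟶ B} (hκ : Q κ) (h : Covers κ κ' m k)
    (h' : Covers κ κ' m' k') (hm : m = m') : k = k' :=
  G.ext hκ (h.trans ((congrArg (· ≫ κ') hm).trans h'.symm))

/-- Monoidal structure reflected along generating lax monoidal data. -/
abbrev LaxData.monoidal {S : MonoidalCategoryStruct D} {M : MonoidalCategory C} {Q : MapClass U}
    (L : LaxData S M U) (G : Generates Q L)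
    (hl : ∀ (X : D) {Y₁ Y₂ : D} (f : Y₁ ⟶ Y₂), S.tensorHom (𝟙 X) f = S.whiskerLeft X f)
    (hr : ∀ {X₁ X₂ : D} (f : X₁ ⟶ X₂) (Y : D), S.tensorHom f (𝟙 Y) = S.whiskerRight f Y) :
    MonoidalCategory D :=
  letI := S
  MonoidalCategory.ofTensorHom (C := D)
    (id_tensorHom := hl) (tensorHom_id := hr)
    -- Every axiom has the same shape: a generating map into its source, one covering chain for each
    -- side, and the axiom of `M`.
    (id_tensorHom_id := fun A B =>
      G.eq (G.tens (G.id A) (G.id B)) (L.covers_tensor (Covers.id _) (Covers.id _))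
        (Covers.id _) (letI := M; MonoidalCategory.id_tensorHom_id _ _))
    (tensorHom_comp_tensorHom := fun {A₁ B₁ E₁ A₂ B₂ E₂} f₁ f₂ g₁ g₂ =>
      G.eq (G.tens (G.id A₁) (G.id A₂))
        ((L.covers_tensor (Covers.map f₁) (Covers.map f₂)).comp
          (L.covers_tensor (Covers.map g₁) (Covers.map g₂)))
        (L.covers_tensor ((Covers.map f₁).comp (Covers.map g₁))
          ((Covers.map f₂).comp (Covers.map g₂)))
        (letI := M; MonoidalCategory.tensorHom_comp_tensorHom _ _ _ _))
    (associator_naturality := fun f₁ f₂ f₃ =>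
      G.eq (G.tens (G.tens (G.id _) (G.id _)) (G.id _))
        ((L.covers_tensor (L.covers_tensor (Covers.map f₁) (Covers.map f₂)) (Covers.map f₃)).comp
          (L.covers_assoc _ _ _))
        ((L.covers_assoc _ _ _).comp
          (L.covers_tensor (Covers.map f₁) (L.covers_tensor (Covers.map f₂) (Covers.map f₃))))
        (letI := M; MonoidalCategory.associator_naturality _ _ _))
    (leftUnitor_naturality := fun f =>
      G.eq (G.tens G.one (G.id _))
        ((L.covers_tensor (Covers.id _) (Covers.map f)).comp (L.covers_left _))
        ((L.covers_left _).comp (Covers.map f))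
        (letI := M; by simp))
    (rightUnitor_naturality := fun f =>
      G.eq (G.tens (G.id _) G.one)
        ((L.covers_tensor (Covers.map f) (Covers.id _)).comp (L.covers_right _))
        ((L.covers_right _).comp (Covers.map f))
        (letI := M; by simp))
    (pentagon := fun A B E F =>
      G.eq (G.tens (G.tens (G.tens (G.id A) (G.id B)) (G.id E)) (G.id F))
        ((L.covers_tensor (L.covers_assoc _ _ _) (Covers.id _)).comp
          ((L.covers_assoc _ _ _).comp (L.covers_tensor (Covers.id _) (L.covers_assoc _ _ _))))
        ((L.covers_assoc _ _ _).comp (L.covers_assoc _ _ _))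
        (letI := M; by simp))
    (triangle := fun A B =>
      G.eq (G.tens (G.tens (G.id A) G.one) (G.id B))
        ((L.covers_assoc _ _ _).comp (L.covers_tensor (Covers.id _) (L.covers_left _)))
        (L.covers_tensor (L.covers_right _) (Covers.id _))
        (letI := M; by simp))

/-- The functor is lax monoidal for the reflected monoidal structure. -/
abbrev LaxData.lax {S : MonoidalCategoryStruct D} {M : MonoidalCategory C} {Q : MapClass U}
    (L : LaxData S M U) (G : Generates Q L)
    (hl : ∀ (X : D) {Y₁ Y₂ : D} (f : Y₁ ⟶ Y₂), S.tensorHom (𝟙 X) f = S.whiskerLeft X f)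
    (hr : ∀ {X₁ X₂ : D} (f : X₁ ⟶ X₂) (Y : D), S.tensorHom f (𝟙 Y) = S.whiskerRight f Y) :
    LaxStr (L.monoidal G hl hr) M U :=
  letI := M
  letI := L.monoidal G hl hr
  { ε := L.one
    μ := L.ten
    μ_natural_left := fun {A B} f E => by
      have h := L.natural f (𝟙 E)
      rw [hr, U.map_id, MonoidalCategory.tensorHom_id] at h
      exact h.symm
    μ_natural_right := fun {A B} E f => by
      have h := L.natural (𝟙 E) f
      rw [hl, U.map_id, MonoidalCategory.id_tensorHom] at h
      exact h.symm
    associativity := fun A B E => by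
      have h := L.assoc A B E
      simp only [Covers, Category.assoc] at h
      rw [← MonoidalCategory.tensorHom_id, ← MonoidalCategory.id_tensorHom]
      exact h
    left_unitality := fun A => by
      have h := L.left A
      simp only [Covers, Category.assoc, Category.comp_id] at h
      rw [← MonoidalCategory.tensorHom_id]
      exact h.symm
    right_unitality := fun A => by
      have h := L.right A
      simp only [Covers, Category.assoc, Category.comp_id] at h
      rw [← MonoidalCategory.id_tensorHom]
      exact h.symm }

end Covers

/-! ### Reflecting duoidal and 3-monoidal structures. -/

section Duoidal

variable {C : Type u} [Category.{v} C] {D : Type u'} [Category.{v'} D] {U : D ⥤ C}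
  {M N P : MonoidalCategory C} {M' N' P' : MonoidalCategory D}

/-- Lifts of the interchange law and of the unit maps of a duoidal structure. -/
structure DuoidalLift (S : DuoidalStr M N) (L : LaxData M'.toMonoidalCategoryStruct M U)
    (K : LaxData N'.toMonoidalCategoryStruct N U) where
  ζ : ∀ A B X Y : D, (A ⊠[N'] B) ⊠[M'] (X ⊠[N'] Y) ⟶ (A ⊠[M'] X) ⊠[N'] (B ⊠[M'] Y)
  Δ : M'.tensorUnit ⟶ M'.tensorUnit ⊠[N'] M'.tensorUnit
  θ : N'.tensorUnit ⊠[M'] N'.tensorUnit ⟶ N'.tensorUnit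
  ι : M'.tensorUnit ⟶ N'.tensorUnit
  ζ_covers : ∀ A B X Y : D, Covers (L.tens (K.ten A B) (K.ten X Y))
    (K.tens (L.ten A X) (L.ten B Y)) (S.ζ _ _ _ _) (ζ A B X Y)
  Δ_covers : Covers L.one (K.tens L.one L.one) S.Δ Δ
  θ_covers : Covers (L.tens K.one K.one) K.one S.θ θ
  ι_covers : Covers L.one K.one S.ι ι

/-- The lifts of the interchange law and of the unit maps given by a double monoidal functor. -/
abbrev IsDoubleLax.lift {S : DuoidalStr M N} {S' : DuoidalStr M' N'} {L : LaxStr M' M U}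
    {K : LaxStr N' N U} (h : IsDoubleLax S' S L K) : DuoidalLift S L.data K.data where
  ζ := S'.ζ
  Δ := S'.Δ
  θ := S'.θ
  ι := S'.ι
  ζ_covers A B X Y := (Category.assoc _ _ _).trans (h.interchange A B X Y)
  Δ_covers := h.unit_first
  θ_covers := (Category.assoc _ _ _).trans h.unit_second
  ι_covers := h.unit_unit

section

variable {S : DuoidalStr M N} {L : LaxData M'.toMonoidalCategoryStruct M U}
  {K : LaxData N'.toMonoidalCategoryStruct N U} (H : DuoidalLift S L K)

theorem DuoidalLift.covers_ζ {X₁ X₂ X₃ X₄ : C} {A₁ A₂ A₃ A₄ : D} (κ₁ : X₁ ⟶ U.obj A₁)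
    (κ₂ : X₂ ⟶ U.obj A₂) (κ₃ : X₃ ⟶ U.obj A₃) (κ₄ : X₄ ⟶ U.obj A₄) :
    Covers (L.tens (K.tens κ₁ κ₂) (K.tens κ₃ κ₄)) (K.tens (L.tens κ₁ κ₃) (L.tens κ₂ κ₄))
      (S.ζ X₁ X₂ X₃ X₄) (H.ζ A₁ A₂ A₃ A₄) := by
  have h := H.ζ_covers A₁ A₂ A₃ A₄
  have h₁ : L.tens (K.tens κ₁ κ₂) (K.tens κ₃ κ₄) = ((κ₁ ⊠ₘ[N] κ₂) ⊠ₘ[M] (κ₃ ⊠ₘ[N] κ₄)) ≫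
      L.tens (K.ten A₁ A₂) (K.ten A₃ A₄) :=
    (tens_comp_assoc M _ _ _ _ _).symm
  have h₂ : K.tens (L.tens κ₁ κ₃) (L.tens κ₂ κ₄) = ((κ₁ ⊠ₘ[M] κ₃) ⊠ₘ[N] (κ₂ ⊠ₘ[M] κ₄)) ≫
      K.tens (L.ten A₁ A₃) (L.ten A₂ A₄) :=
    (tens_comp_assoc N _ _ _ _ _).symm
  unfold Covers at *
  rw [h₁, Category.assoc, h, h₂, reassoc_of% S.ζ_natural]

/-- Lifts of the interchange law and of the unit maps form a duoidal structure. -/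
abbrev DuoidalLift.duoidal {Q R : MapClass U} (G : Generates Q L) (F : Generates R K)
    (hQ : ∀ ⦃X : C⦄ ⦃A : D⦄ ⦃κ : X ⟶ U.obj A⦄, R κ → Q κ) : DuoidalStr M' N' where
  ζ := H.ζ
  Δ := H.Δ
  θ := H.θ
  ι := H.ι
  -- The sources are products for `M'` of products for `N'`. The inner ones are generating for `R`,
  -- and `hQ` moves them to `Q` before the outer product is taken; the opposite inclusion never
  -- intervenes.
  ζ_natural f g h k :=
    G.eq (G.tens (hQ (F.tens (F.id _) (F.id _))) (hQ (F.tens (F.id _) (F.id _))))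
      ((L.covers_tensor (K.covers_tensor (Covers.map f) (Covers.map g))
        (K.covers_tensor (Covers.map h) (Covers.map k))).comp (H.covers_ζ _ _ _ _))
      ((H.covers_ζ _ _ _ _).comp (K.covers_tensor (L.covers_tensor (Covers.map f) (Covers.map h))
        (L.covers_tensor (Covers.map g) (Covers.map k))))
      (S.ζ_natural _ _ _ _)
  ζ_assoc_left A B X Y E E' :=
    G.eq (G.tens (G.tens (hQ (F.tens (F.id A) (F.id B))) (hQ (F.tens (F.id X) (F.id Y))))
        (hQ (F.tens (F.id E) (F.id E'))))
      ((L.covers_tensor (H.covers_ζ _ _ _ _) (Covers.id _)).comp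
        ((H.covers_ζ _ _ _ _).comp
          (K.covers_tensor (L.covers_assoc _ _ _) (L.covers_assoc _ _ _))))
      ((L.covers_assoc _ _ _).comp ((L.covers_tensor (Covers.id _) (H.covers_ζ _ _ _ _)).comp
        (H.covers_ζ _ _ _ _)))
      (S.ζ_assoc_left _ _ _ _ _ _)
  ζ_assoc_right A B X Y E E' :=
    G.eq (G.tens (hQ (F.tens (F.tens (F.id A) (F.id B)) (F.id X)))
        (hQ (F.tens (F.tens (F.id Y) (F.id E)) (F.id E'))))
      ((H.covers_ζ _ _ _ _).comp ((K.covers_tensor (H.covers_ζ _ _ _ _) (Covers.id _)).comp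
        (K.covers_assoc _ _ _)))
      ((L.covers_tensor (K.covers_assoc _ _ _) (K.covers_assoc _ _ _)).comp
        ((H.covers_ζ _ _ _ _).comp (K.covers_tensor (Covers.id _) (H.covers_ζ _ _ _ _))))
      (S.ζ_assoc_right _ _ _ _ _ _)
  Δ_left_unit A B :=
    G.eq (G.tens G.one (hQ (F.tens (F.id A) (F.id B))))
      ((L.covers_tensor H.Δ_covers (Covers.id _)).comp ((H.covers_ζ _ _ _ _).comp
        (K.covers_tensor (L.covers_left _) (L.covers_left _))))
      (L.covers_left _) (S.Δ_left_unit _ _)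
  Δ_right_unit A B :=
    G.eq (G.tens (hQ (F.tens (F.id A) (F.id B))) G.one)
      ((L.covers_tensor (Covers.id _) H.Δ_covers).comp ((H.covers_ζ _ _ _ _).comp
        (K.covers_tensor (L.covers_right _) (L.covers_right _))))
      (L.covers_right _) (S.Δ_right_unit _ _)
  θ_left_unit A B :=
    G.eq (G.tens (hQ (F.tens F.one (F.id A))) (hQ (F.tens F.one (F.id B))))
      ((H.covers_ζ _ _ _ _).comp ((K.covers_tensor H.θ_covers (Covers.id _)).comp
        (K.covers_left _)))
      (L.covers_tensor (K.covers_left _) (K.covers_left _)) (S.θ_left_unit _ _)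
  θ_right_unit A B :=
    G.eq (G.tens (hQ (F.tens (F.id A) F.one)) (hQ (F.tens (F.id B) F.one)))
      ((H.covers_ζ _ _ _ _).comp ((K.covers_tensor (Covers.id _) H.θ_covers).comp
        (K.covers_right _)))
      (L.covers_tensor (K.covers_right _) (K.covers_right _)) (S.θ_right_unit _ _)
  monoid_one_mul :=
    G.eq (G.tens G.one (hQ F.one))
      ((L.covers_tensor H.ι_covers (Covers.id _)).comp H.θ_covers) (L.covers_left _)
      S.monoid_one_mul
  monoid_mul_one :=
    G.eq (G.tens (hQ F.one) G.one)
      ((L.covers_tensor (Covers.id _) H.ι_covers).comp H.θ_covers) (L.covers_right _)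
      S.monoid_mul_one
  monoid_assoc :=
    G.eq (G.tens (G.tens (hQ F.one) (hQ F.one)) (hQ F.one))
      ((L.covers_tensor H.θ_covers (Covers.id _)).comp H.θ_covers)
      ((L.covers_assoc _ _ _).comp ((L.covers_tensor (Covers.id _) H.θ_covers).comp H.θ_covers))
      S.monoid_assoc
  comonoid_counit_comul :=
    G.eq G.one (H.Δ_covers.comp (K.covers_tensor H.ι_covers (Covers.id _)))
      (Covers.inv (K.covers_left L.one)) S.comonoid_counit_comul
  comonoid_comul_counit :=
    G.eq G.one (H.Δ_covers.comp (K.covers_tensor (Covers.id _) H.ι_covers))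
      (Covers.inv (K.covers_right L.one)) S.comonoid_comul_counit
  comonoid_coassoc :=
    G.eq G.one (H.Δ_covers.comp ((K.covers_tensor H.Δ_covers (Covers.id _)).comp
        (K.covers_assoc _ _ _)))
      (H.Δ_covers.comp (K.covers_tensor (Covers.id _) H.Δ_covers)) S.comonoid_coassoc

end

theorem DuoidalLift.isDoubleLax {S : DuoidalStr M N} {L : LaxStr M' M U} {K : LaxStr N' N U}
    (H : DuoidalLift S L.data K.data) {Q R : MapClass U} (G : Generates Q L.data)
    (F : Generates R K.data) (hQ : ∀ ⦃X : C⦄ ⦃A : D⦄ ⦃κ : X ⟶ U.obj A⦄, R κ → Q κ) :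
    IsDoubleLax (H.duoidal G F hQ) S L K where
  interchange A B X Y := (Category.assoc _ _ _).symm.trans (H.ζ_covers A B X Y)
  unit_first := H.Δ_covers
  unit_second := (Category.assoc _ _ _).symm.trans H.θ_covers
  unit_unit := H.ι_covers

/-- The axioms of a 3-monoidal category are reflected along generating double monoidal
structures. -/
theorem IsTrioidal.of_isDoubleLax {S₁₂ : DuoidalStr M N} {S₁₃ : DuoidalStr M P}
    {S₂₃ : DuoidalStr N P} (S : IsTrioidal S₁₂ S₁₃ S₂₃) {S₁₂' : DuoidalStr M' N'}
    {S₁₃' : DuoidalStr M' P'} {S₂₃' : DuoidalStr N' P'} {L : LaxStr M' M U} {K : LaxStr N' N U}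
    {J : LaxStr P' P U} (h₁₂ : IsDoubleLax S₁₂' S₁₂ L K) (h₁₃ : IsDoubleLax S₁₃' S₁₃ L J)
    (h₂₃ : IsDoubleLax S₂₃' S₂₃ K J) {Q R O : MapClass U} (G : Generates Q L.data)
    (F : Generates R K.data) (E : Generates O J.data)
    (hQ : ∀ ⦃X : C⦄ ⦃A : D⦄ ⦃κ : X ⟶ U.obj A⦄, R κ → Q κ)
    (hR : ∀ ⦃X : C⦄ ⦃A : D⦄ ⦃κ : X ⟶ U.obj A⦄, O κ → R κ) :
    IsTrioidal S₁₂' S₁₃' S₂₃' where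
  -- The products are nested with `M'` outermost and `P'` innermost, which matches the inclusions of
  -- `O` in `R` and of `R` in `Q`.
  interchange A₁ B₁ A₂ B₂ C₁ D₁ C₂ D₂ :=
    G.eq
      (G.tens (hQ (F.tens (hR (E.tens (E.id A₁) (E.id B₁))) (hR (E.tens (E.id A₂) (E.id B₂)))))
        (hQ (F.tens (hR (E.tens (E.id C₁) (E.id D₁))) (hR (E.tens (E.id C₂) (E.id D₂))))))
      ((h₁₂.lift.covers_ζ _ _ _ _).comp
        ((K.data.covers_tensor (h₁₃.lift.covers_ζ _ _ _ _) (h₁₃.lift.covers_ζ _ _ _ _)).comp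
          (h₂₃.lift.covers_ζ _ _ _ _)))
      ((L.data.covers_tensor (h₂₃.lift.covers_ζ _ _ _ _) (h₂₃.lift.covers_ζ _ _ _ _)).comp
        ((h₁₃.lift.covers_ζ _ _ _ _).comp
          (J.data.covers_tensor (h₁₂.lift.covers_ζ _ _ _ _) (h₁₂.lift.covers_ζ _ _ _ _))))
      (S.interchange _ _ _ _ _ _ _ _)
  unit_first :=
    G.eq G.one
      (h₁₂.lift.Δ_covers.comp
        ((K.data.covers_tensor h₁₃.lift.Δ_covers h₁₃.lift.Δ_covers).comp
          (h₂₃.lift.covers_ζ _ _ _ _)))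
      (h₁₃.lift.Δ_covers.comp (J.data.covers_tensor h₁₂.lift.Δ_covers h₁₂.lift.Δ_covers))
      S.unit_first
  unit_second :=
    G.eq (G.tens (hQ F.one) (hQ F.one)) (h₁₂.lift.θ_covers.comp h₂₃.lift.Δ_covers)
      ((L.data.covers_tensor h₂₃.lift.Δ_covers h₂₃.lift.Δ_covers).comp
        ((h₁₃.lift.covers_ζ _ _ _ _).comp
          (J.data.covers_tensor h₁₂.lift.θ_covers h₁₂.lift.θ_covers)))
      S.unit_second
  unit_third :=
    G.eq (G.tens (hQ (F.tens (hR E.one) (hR E.one))) (hQ (F.tens (hR E.one) (hR E.one))))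
      ((L.data.covers_tensor h₂₃.lift.θ_covers h₂₃.lift.θ_covers).comp h₁₃.lift.θ_covers)
      ((h₁₂.lift.covers_ζ _ _ _ _).comp
        ((K.data.covers_tensor h₁₃.lift.θ_covers h₁₃.lift.θ_covers).comp h₂₃.lift.θ_covers))
      S.unit_third
  unit_first_second :=
    G.eq G.one (h₁₂.lift.ι_covers.comp h₂₃.lift.Δ_covers)
      (h₁₃.lift.Δ_covers.comp (J.data.covers_tensor h₁₂.lift.ι_covers h₁₂.lift.ι_covers))
      S.unit_first_second
  unit_first_third :=
    G.eq G.one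
      (h₁₂.lift.Δ_covers.comp ((K.data.covers_tensor h₁₃.lift.ι_covers h₁₃.lift.ι_covers).comp
        h₂₃.lift.θ_covers))
      h₁₃.lift.ι_covers S.unit_first_third
  unit_second_third :=
    G.eq (G.tens (hQ F.one) (hQ F.one)) (h₁₂.lift.θ_covers.comp h₂₃.lift.ι_covers)
      ((L.data.covers_tensor h₂₃.lift.ι_covers h₂₃.lift.ι_covers).comp h₁₃.lift.θ_covers)
      S.unit_second_third
  unit_triangle :=
    G.eq G.one (h₁₂.lift.ι_covers.comp h₂₃.lift.ι_covers) h₁₃.lift.ι_covers S.unit_triangle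

end Duoidal

/-! ### Reflexive coequalizers and their preservation. -/

section Coequalizers

variable {C : Type u} [Category.{v} C] {D : Type u'} [Category.{v} D]

/-- The map `π` is a coequalizer of `f` and `g`. -/
structure IsCoeq {X Y Z : C} (f g : X ⟶ Y) (π : Y ⟶ Z) : Prop where
  w : f ≫ π = g ≫ π
  desc : ∀ {W : C} (h : Y ⟶ W), f ≫ h = g ≫ h → ∃ k : Z ⟶ W, π ≫ k = h
  ext : ∀ {W : C} {k k' : Z ⟶ W}, π ≫ k = π ≫ k' → k = k'

theorem IsCoeq.of_isColimit {X Y Z : C} {f g : X ⟶ Y} {π : Y ⟶ Z} (w : f ≫ π = g ≫ π)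
    (h : IsColimit (Cofork.ofπ π w)) : IsCoeq f g π where
  w := w
  desc k hk := ⟨h.desc (Cofork.ofπ k hk), h.fac (Cofork.ofπ k hk) WalkingParallelPair.one⟩
  ext hk := Cofork.IsColimit.hom_ext h hk

/-- A coequalizer as a colimit cofork. -/
theorem IsCoeq.nonempty_isColimit {X Y Z : C} {f g : X ⟶ Y} {π : Y ⟶ Z} (h : IsCoeq f g π) :
    Nonempty (IsColimit (Cofork.ofπ π h.w)) :=
  ⟨Cofork.IsColimit.mk _ (fun s => (h.desc s.π s.condition).choose)
    (fun s => (h.desc s.π s.condition).choose_spec)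
    (fun s _ hm => h.ext (hm.trans (h.desc s.π s.condition).choose_spec.symm))⟩

theorem IsCoeq.map {X Y Z : C} {f g : X ⟶ Y} {π : Y ⟶ Z} (h : IsCoeq f g π) (F : C ⥤ D)
    [Monad.PreservesColimitOfIsReflexivePair F] {s : Y ⟶ X} (hf : s ≫ f = 𝟙 Y)
    (hg : s ≫ g = 𝟙 Y) : IsCoeq (F.map f) (F.map g) (F.map π) := by
  have := IsReflexivePair.mk' s hf hg
  obtain ⟨hc⟩ := h.nonempty_isColimit
  exact .of_isColimit _ (isColimitCoforkMapOfIsColimit F h.w hc)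

/-- Coequalizers in a product category are computed componentwise, so a tensor functor that
preserves reflexive ones can be applied to both variables at once. -/
theorem IsCoeq.prod {X Y Z : C} {f g : X ⟶ Y} {π : Y ⟶ Z} {X' Y' Z' : D} {f' g' : X' ⟶ Y'}
    {π' : Y' ⟶ Z'} (h : IsCoeq f g π) (h' : IsCoeq f' g' π') :
    IsCoeq (C := C × D) (X := (X, X')) (Y := (Y, Y')) (Z := (Z, Z')) (Prod.mkHom f f')
      (Prod.mkHom g g') (Prod.mkHom π π') where
  w := Prod.ext h.w h'.w
  desc k hk := by
    obtain ⟨l, hl⟩ := h.desc k.1 (congrArg Prod.fst hk)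
    obtain ⟨l', hl'⟩ := h'.desc k.2 (congrArg Prod.snd hk)
    exact ⟨Prod.mkHom l l', Prod.ext hl hl'⟩
  ext hk := Prod.ext (h.ext (congrArg Prod.fst hk)) (h'.ext (congrArg Prod.snd hk))

theorem IsCoeq.tens {M : MonoidalCategory C}
    (hM : Monad.PreservesColimitOfIsReflexivePair (@MonoidalCategory.tensor C _ M))
    {X Y Z X' Y' Z' : C} {f g : X ⟶ Y} {π : Y ⟶ Z} {f' g' : X' ⟶ Y'}
    {π' : Y' ⟶ Z'} (h : IsCoeq f g π) (h' : IsCoeq f' g' π') {s : Y ⟶ X} (hf : s ≫ f = 𝟙 Y)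
    (hg : s ≫ g = 𝟙 Y) {s' : Y' ⟶ X'} (hf' : s' ≫ f' = 𝟙 Y') (hg' : s' ≫ g' = 𝟙 Y') :
    IsCoeq (f ⊠ₘ[M] f') (g ⊠ₘ[M] g') (π ⊠ₘ[M] π') :=
  (h.prod h').map (@MonoidalCategory.tensor C _ M) (s := Prod.mkHom s s')
    (Prod.ext hf hf') (Prod.ext hg hg')

theorem exists_isCoeq [HasReflexiveCoequalizers C] {X Y : C} {f g : X ⟶ Y} {s : Y ⟶ X}
    (hf : s ≫ f = 𝟙 Y) (hg : s ≫ g = 𝟙 Y) : ∃ (Z : C) (π : Y ⟶ Z), IsCoeq f g π := by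
  have := IsReflexivePair.mk' s hf hg
  have := HasReflexiveCoequalizers.has_coeq f g
  exact ⟨_, coequalizer.π f g, .of_isColimit _ (coequalizerIsCoequalizer f g)⟩

end Coequalizers

/-! ### Algebras presented by generators and relations. -/

section Presentations

variable {C : Type u} [Category.{v} C] {T : Monad C}

theorem unit_natural {X Y : C} (f : X ⟶ Y) : f ≫ T.η.app Y = T.η.app X ≫ T.map f :=
  T.η.naturality f

theorem mul_natural {X Y : C} (f : X ⟶ Y) :
    T.map (T.map f) ≫ T.μ.app Y = T.μ.app X ≫ T.map f :=
  T.μ.naturality f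

/-- The algebra `A` is presented by `g : X ⟶ A`: it is generated by `X` subject to the relations
`r = t`, where `r : R ⟶ X` and `t : R ⟶ T X` have a common section `s` in the Kleisli category. -/
structure Presents {R X : C} (s : X ⟶ R) (r : R ⟶ X) (t : R ⟶ T.obj X) {A : T.Algebra}
    (g : X ⟶ A.A) : Prop where
  section_fst : s ≫ r = 𝟙 X
  section_snd : s ≫ t = T.η.app X
  w : t ≫ T.map g ≫ A.a = r ≫ g
  desc : ∀ {Z : T.Algebra} (h : X ⟶ Z.A), t ≫ T.map h ≫ Z.a = r ≫ h →
    ∃ k : A ⟶ Z, g ≫ k.f = h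
  ext : ∀ {Z : T.Algebra} {k k' : A ⟶ Z}, g ≫ k.f = g ≫ k'.f → k = k'

section

variable {R X : C} {s : X ⟶ R} {r : R ⟶ X} {t : R ⟶ T.obj X}

/-- With the next lemma: a common section in the Kleisli category becomes a common section of `T r`
and `μ ∘ T t`, so this pair is reflexive in `C`. -/
theorem section_map_fst (h₁ : s ≫ r = 𝟙 X) : T.map s ≫ T.map r = 𝟙 (T.obj X) := by
  rw [← T.map_comp, h₁, T.map_id]

theorem section_map_snd (h₂ : s ≫ t = T.η.app X) :
    T.map s ≫ T.map t ≫ T.μ.app X = 𝟙 (T.obj X) := by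
  rw [← Category.assoc, ← T.map_comp, h₂]
  exact T.right_unit X

/-- The forgetful functor creates this coequalizer: as `T` preserves the coequalizer of `T r` and `μ
∘ T t` taken in `C`, the quotient inherits an action. -/
theorem exists_presents [HasReflexiveCoequalizers C]
    [Monad.PreservesColimitOfIsReflexivePair T.toFunctor] (h₁ : s ≫ r = 𝟙 X)
    (h₂ : s ≫ t = T.η.app X) :
    ∃ (A : T.Algebra) (g : X ⟶ A.A), Presents s r t g ∧
      IsCoeq (T.map r) (T.map t ≫ T.μ.app X) (T.map g ≫ A.a) := by
  have e₁ := section_map_fst (T := T) h₁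
  have e₂ := section_map_snd h₂
  obtain ⟨Q, π, hπ⟩ := exists_isCoeq e₁ e₂
  have hT := hπ.map T.toFunctor e₁ e₂
  have e₁' := section_map_fst (T := T) e₁
  have e₂' : T.map (T.map s) ≫ T.map (T.map t ≫ T.μ.app X) = 𝟙 _ := by
    rw [← T.map_comp, e₂, T.map_id]
  have hTT := hT.map T.toFunctor e₁' e₂'
  -- The action `q` is the descent of `μ ≫ π` along `T π`. Its unit law is tested on `π`, its
  -- associativity on `T (T π)`.
  obtain ⟨q, hq⟩ := hT.desc (T.μ.app X ≫ π) (by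
    rw [reassoc_of% mul_natural r, hπ.w, T.map_comp, Category.assoc, Category.assoc,
      reassoc_of% T.assoc X, reassoc_of% mul_natural t])
  let A : T.Algebra :=
    { A := Q
      a := q
      unit := hπ.ext (by
        rw [reassoc_of% unit_natural π, hq, reassoc_of% T.left_unit X, Category.comp_id])
      assoc := hTT.ext (by
        rw [reassoc_of% mul_natural π, hq, ← T.map_comp_assoc, hq, T.map_comp_assoc, hq,
          ← Category.assoc, ← Category.assoc, T.assoc]) }
  -- The quotient map is the extension of its restriction to the generators.
  have hg : T.map (T.η.app X ≫ π) ≫ A.a = π := by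
    rw [T.map_comp, Category.assoc, show T.map π ≫ A.a = _ from hq, ← Category.assoc,
      T.right_unit, Category.id_comp]
  refine ⟨A, T.η.app X ≫ π, ⟨h₁, h₂, ?_, ?_, ?_⟩, ?_⟩
  · rw [hg, reassoc_of% unit_natural r, hπ.w, Category.assoc,
      ← reassoc_of% unit_natural t, reassoc_of% T.left_unit X]
  · intro Z h hh
    obtain ⟨k, hk⟩ := hπ.desc (T.map h ≫ Z.a) (by
      rw [← T.map_comp_assoc, ← hh, T.map_comp, T.map_comp, Category.assoc, Category.assoc,
        ← Z.assoc, reassoc_of% mul_natural h, Category.assoc])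
    refine ⟨⟨k, hT.ext ?_⟩, ?_⟩
    · rw [reassoc_of% show T.map π ≫ A.a = _ from hq, hk, ← T.map_comp_assoc, hk, T.map_comp,
        Category.assoc, ← Z.assoc, reassoc_of% mul_natural h]
    · rw [Category.assoc, hk, ← reassoc_of% unit_natural h, Z.unit, Category.comp_id]
  · intro Z k k' hk
    ext
    refine hπ.ext ?_
    rw [← hg, Category.assoc, Category.assoc, ← k.h, ← k'.h, ← T.map_comp_assoc,
      ← T.map_comp_assoc, hk]
  · rwa [hg]

/-- A presentation is a universal property among algebras only. Comparison with the algebra built in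
`exists_presents` shows that it is also a coequalizer in `C`, to which preservation hypotheses
apply. -/
theorem Presents.isCoeq [HasReflexiveCoequalizers C]
    [Monad.PreservesColimitOfIsReflexivePair T.toFunctor] {A : T.Algebra} {g : X ⟶ A.A}
    (h : Presents s r t g) : IsCoeq (T.map r) (T.map t ≫ T.μ.app X) (T.map g ≫ A.a) := by
  obtain ⟨B, g', h', hB⟩ := exists_presents h.section_fst h.section_snd
  obtain ⟨k, hk⟩ := h.desc g' h'.w
  obtain ⟨l, hl⟩ := h'.desc g h.w
  have hkl : k ≫ l = 𝟙 A := h.ext (by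
    rw [Monad.Algebra.comp_f, reassoc_of% hk, hl, Monad.Algebra.id_f, Category.comp_id])
  have hlf : (T.map g' ≫ B.a) ≫ l.f = T.map g ≫ A.a := by
    rw [Category.assoc, ← l.h, ← T.map_comp_assoc, hl]
  have hkf : (T.map g ≫ A.a) ≫ k.f = T.map g' ≫ B.a := by
    rw [Category.assoc, ← k.h, ← T.map_comp_assoc, hk]
  -- The identity `k ≫ l = 𝟙 A` suffices: a retract of a coequalizer, compatible with the quotient
  -- maps, is again a coequalizer of the same pair.
  refine ⟨?_, fun f hf => ?_, fun {W f f'} hf => ?_⟩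
  · rw [← hlf, ← Category.assoc, hB.w, Category.assoc]
  · obtain ⟨m, hm⟩ := hB.desc f hf
    exact ⟨k.f ≫ m, by rw [← Category.assoc, hkf, hm]⟩
  · have hm : l.f ≫ f = l.f ≫ f' :=
      hB.ext (by rw [← Category.assoc, hlf, hf, ← hlf, Category.assoc])
    have hkl' : k.f ≫ l.f = 𝟙 A.A := congrArg Monad.Algebra.Hom.f hkl
    rw [← Category.id_comp f, ← hkl', Category.assoc, hm, ← Category.assoc, hkl', Category.id_comp]

end

/-- The tautological presentation: all of `T X` serves as relations, with `r` the transported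
action, so that respecting the relations means being a morphism of algebras. -/
theorem presents_of_isIso {X : C} {A : T.Algebra} (g : X ⟶ A.A) [IsIso g] {r : T.obj X ⟶ X}
    (hr : T.map g ≫ A.a = r ≫ g) : Presents (T.η.app X) r (𝟙 (T.obj X)) g where
  section_fst := by
    rw [← cancel_mono g, Category.assoc, ← hr, ← reassoc_of% unit_natural g, A.unit,
      Category.comp_id]
    exact (Category.id_comp g).symm
  section_snd := Category.comp_id _
  w := (Category.id_comp _).trans hr
  desc {Z} h hh := by
    refine ⟨⟨inv g ≫ h, ?_⟩, by simp⟩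
    rw [Category.id_comp] at hh
    rw [← cancel_epi (T.map g), ← T.map_comp_assoc, IsIso.hom_inv_id_assoc, hh,
      reassoc_of% hr, IsIso.hom_inv_id_assoc]
  ext {Z k k'} h := by
    ext
    exact (cancel_epi g).1 h

/-- A free algebra has only trivial relations, `R = X` with `r = 𝟙` and `t = η`. -/
theorem presents_unit (X : C) :
    Presents (𝟙 X) (𝟙 X) (T.η.app X) (A := T.free.obj X) (T.η.app X) where
  section_fst := Category.comp_id _
  section_snd := Category.id_comp _
  w := by
    dsimp [Monad.free]
    rw [T.right_unit, Category.id_comp]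
    exact Category.comp_id _
  desc {Z} h hh := ⟨extend h, by
    simp only [extend, Monad.adj, Adjunction.mkOfHomEquiv_homEquiv, Equiv.coe_fn_symm_mk]
    exact hh.trans (Category.id_comp h)⟩
  ext {Z k k'} h := (T.adj.homEquiv X Z).injective (by
    simp only [Monad.adj, Adjunction.mkOfHomEquiv_homEquiv, Equiv.coe_fn_mk]
    exact h)

end Presentations

/-! ### Presentations and monoidal monads. -/

section LaxMonad

variable {C : Type u} [Category.{v} C] {M : MonoidalCategory C} {T : Monad C}

namespace LaxMonadStr

variable (γ : LaxMonadStr M T)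

theorem φ₀_eq : γ.lax.φ₀ = T.η.app M.tensorUnit := by
  let := γ.lax
  have h := γ.unit_isMonoidal.unit
  simpa using h.symm

theorem unit_tens (X Y : C) :
    (T.η.app X ⊠ₘ[M] T.η.app Y) ≫ γ.lax.φ X Y = T.η.app (X ⊠[M] Y) := by
  let := γ.lax
  have h := γ.unit_isMonoidal.tensor X Y
  simpa using h.symm

theorem mul_tens (X Y : C) :
    γ.lax.φ (T.obj X) (T.obj Y) ≫ T.map (γ.lax.φ X Y) ≫ T.μ.app (X ⊠[M] Y) =
      (T.μ.app X ⊠ₘ[M] T.μ.app Y) ≫ γ.lax.φ X Y := by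
  let := γ.lax
  have h := γ.mul_isMonoidal.tensor X Y
  simpa using h

theorem φ_natural {X Y X' Y' : C} (f : X ⟶ Y) (g : X' ⟶ Y') :
    (T.map f ⊠ₘ[M] T.map g) ≫ γ.lax.φ Y Y' = γ.lax.φ X X' ≫ T.map (f ⊠ₘ[M] g) :=
  (γ.lax.data.natural f g).symm

end LaxMonadStr

/-- Maps out of a tensor product of algebras are bilinear if they are so on generators. -/
theorem Presents.tens [HasReflexiveCoequalizers C]
    [Monad.PreservesColimitOfIsReflexivePair T.toFunctor]
    (hM : Monad.PreservesColimitOfIsReflexivePair (@MonoidalCategory.tensor C _ M))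
    (γ : LaxMonadStr M T) {X₁ R₁ X₂ R₂ : C} {s₁ : X₁ ⟶ R₁} {r₁ : R₁ ⟶ X₁} {t₁ : R₁ ⟶ T.obj X₁}
    {s₂ : X₂ ⟶ R₂} {r₂ : R₂ ⟶ X₂} {t₂ : R₂ ⟶ T.obj X₂} {A₁ A₂ Z : T.Algebra} {g₁ : X₁ ⟶ A₁.A}
    {g₂ : X₂ ⟶ A₂.A} {u : A₁.A ⊠[M] A₂.A ⟶ Z.A} (h₁ : Presents s₁ r₁ t₁ g₁)
    (h₂ : Presents s₂ r₂ t₂ g₂)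
    (hu : Presents (T.η.app A₁.A ⊠ₘ[M] T.η.app A₂.A) (A₁.a ⊠ₘ[M] A₂.a) (γ.lax.φ A₁.A A₂.A) u) :
    Presents (s₁ ⊠ₘ[M] s₂) (r₁ ⊠ₘ[M] r₂) ((t₁ ⊠ₘ[M] t₂) ≫ γ.lax.φ X₁ X₂)
      ((g₁ ⊠ₘ[M] g₂) ≫ u) := by
  have e₁ := section_map_fst (T := T) h₁.section_fst
  have e₁' := section_map_snd h₁.section_snd
  have e₂ := section_map_fst (T := T) h₂.section_fst
  have e₂' := section_map_snd h₂.section_snd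
  -- `E` exhibits `A₁ ⊗ A₂` as a quotient of `T X₁ ⊗ T X₂` and will produce maps out of it. `E'`
  -- exhibits `T A₁ ⊗ T A₂` as a quotient of `T (T X₁) ⊗ T (T X₂)` and will test bilinearity.
  have E := h₁.isCoeq.tens hM h₂.isCoeq e₁ e₁' e₂ e₂'
  have E' := (h₁.isCoeq.map T.toFunctor e₁ e₁').tens hM (h₂.isCoeq.map T.toFunctor e₂ e₂')
    (s := T.map (T.map s₁)) (s' := T.map (T.map s₂))
    (by rw [← T.map_comp, e₁, T.map_id]) (by rw [← T.map_comp, e₁', T.map_id])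
    (by rw [← T.map_comp, e₂, T.map_id]) (by rw [← T.map_comp, e₂', T.map_id])
  refine ⟨?_, ?_, ?_, ?_, ?_⟩
  · rw [tens_comp, h₁.section_fst, h₂.section_fst, tens_id]
  · rw [tens_comp_assoc, h₁.section_snd, h₂.section_snd, γ.unit_tens]
  · rw [T.map_comp, Category.assoc, Category.assoc, ← reassoc_of% γ.φ_natural g₁ g₂, hu.w,
      tens_comp_assoc, tens_comp_assoc, tens_comp_assoc, Category.assoc, Category.assoc, h₁.w,
      h₂.w]
  · intro Z h hh
    rw [Category.assoc] at hh
    -- The bilinear extension of `h` to `T X₁ ⊗ T X₂` descends because `h` respects the relations.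
    obtain ⟨k, hk⟩ := E.desc (γ.lax.φ X₁ X₂ ≫ T.map h ≫ Z.a) (by
      rw [reassoc_of% γ.φ_natural, ← T.map_comp_assoc, ← hh, ← tens_comp, Category.assoc,
        ← reassoc_of% γ.mul_tens X₁ X₂, reassoc_of% γ.φ_natural, T.map_comp, T.map_comp,
        T.map_comp]
      simp only [Category.assoc]
      rw [← Z.assoc, reassoc_of% mul_natural h])
    -- Bilinearity of `k`: after precomposition with `E'`, both sides reduce to the extension of
    -- `h`, by compatibility of `φ` with `μ`.
    obtain ⟨l, hl⟩ := hu.desc k (E'.ext (by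
      rw [reassoc_of% γ.φ_natural, ← T.map_comp_assoc, hk, tens_comp_assoc, T.map_comp,
        T.map_comp, Category.assoc, Category.assoc, ← Z.assoc, reassoc_of% mul_natural h,
        reassoc_of% γ.mul_tens X₁ X₂, T.map_comp, T.map_comp, Category.assoc, Category.assoc,
        ← A₁.assoc, ← A₂.assoc, reassoc_of% mul_natural g₁, reassoc_of% mul_natural g₂,
        ← tens_comp_assoc, hk]))
    refine ⟨l, ?_⟩
    rw [Category.assoc, hl]
    have hg : g₁ ⊠ₘ[M] g₂ = (T.η.app X₁ ⊠ₘ[M] T.η.app X₂) ≫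
        ((T.map g₁ ≫ A₁.a) ⊠ₘ[M] (T.map g₂ ≫ A₂.a)) := by
      rw [tens_comp, ← reassoc_of% unit_natural g₁, ← reassoc_of% unit_natural g₂, A₁.unit,
        A₂.unit, Category.comp_id, Category.comp_id]
    rw [hg, Category.assoc, hk, reassoc_of% γ.unit_tens X₁ X₂, ← reassoc_of% unit_natural h,
      Z.unit, Category.comp_id]
  · intro Z k k' hk
    -- The right-hand side depends on `l` only through its values on the generators.
    have key : ∀ l : _ ⟶ Z, ((T.map g₁ ≫ A₁.a) ⊠ₘ[M] (T.map g₂ ≫ A₂.a)) ≫ u ≫ l.f =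
        γ.lax.φ X₁ X₂ ≫ T.map (((g₁ ⊠ₘ[M] g₂) ≫ u) ≫ l.f) ≫ Z.a := by
      intro l
      rw [← tens_comp_assoc, ← reassoc_of% hu.w, ← l.h, reassoc_of% γ.φ_natural g₁ g₂]
      simp only [T.map_comp, Category.assoc]
    exact hu.ext (E.ext (by rw [key, key, hk]))

end LaxMonad

/-! ### Morphisms induced by maps of presentations. -/

section

variable {C : Type u} [Category.{v} C] {T : Monad C}

theorem presents_id (A : T.Algebra) :
    Presents (T.η.app A.A) A.a (𝟙 (T.obj A.A)) (𝟙 A.A) :=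
  presents_of_isIso _ (by simp)

/-- A map of generators carrying relations to relations extends to algebras. Of the target only the
validity of its relations matters, not its universal property. -/
theorem Presents.exists_covers {R X R' X' : C} {s : X ⟶ R} {r : R ⟶ X} {t : R ⟶ T.obj X}
    {r' : R' ⟶ X'} {t' : R' ⟶ T.obj X'} {A B : T.Algebra} {g : X ⟶ A.A} {g' : X' ⟶ B.A}
    (h : Presents s r t g) (w' : t' ≫ T.map g' ≫ B.a = r' ≫ g') (m : X ⟶ X') (n : R ⟶ R')
    (hr : r ≫ m = n ≫ r') (ht : t ≫ T.map m = n ≫ t') :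
    ∃ k : A ⟶ B, Covers (U := T.forget) g g' m k :=
  h.desc (m ≫ g') (by
    rw [T.map_comp, Category.assoc, reassoc_of% ht, w', reassoc_of% hr])

theorem Presents.exists_covers_iso {R X R' X' : C} {s : X ⟶ R} {r : R ⟶ X} {t : R ⟶ T.obj X}
    {s' : X' ⟶ R'} {r' : R' ⟶ X'} {t' : R' ⟶ T.obj X'} {A B : T.Algebra} {g : X ⟶ A.A}
    {g' : X' ⟶ B.A} (h : Presents s r t g) (h' : Presents s' r' t' g') (m : X ≅ X') (n : R ≅ R')
    (hr : r ≫ m.hom = n.hom ≫ r') (ht : t ≫ T.map m.hom = n.hom ≫ t') :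
    ∃ k : A ≅ B, Covers (U := T.forget) g g' m.hom k.hom := by
  obtain ⟨k, hk⟩ := h.exists_covers h'.w m.hom n.hom hr ht
  obtain ⟨l, hl⟩ := h'.exists_covers h.w m.inv n.inv
    (by rw [Iso.comp_inv_eq, Category.assoc, hr, n.inv_hom_id_assoc])
    (by rw [← cancel_mono (T.map m.hom), Category.assoc, Category.assoc, ht, ← T.map_comp,
      m.inv_hom_id, T.map_id, n.inv_hom_id_assoc, Category.comp_id])
  refine ⟨⟨k, l, h.ext ?_, h'.ext ?_⟩, hk⟩
  · have := hk.comp hl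
    rw [m.hom_inv_id] at this
    exact this.trans (Covers.id (U := T.forget) g).symm
  · have := hl.comp hk
    rw [m.inv_hom_id] at this
    exact this.trans (Covers.id (U := T.forget) g').symm

variable (T) in
/-- The maps which present an algebra. -/
def Presented : MapClass T.forget := fun X A g =>
  ∃ (R : C) (s : X ⟶ R) (r : R ⟶ X) (t : R ⟶ T.obj X), Presents (A := A) s r t g

theorem extend_f {X : C} {W : T.Algebra} (f : X ⟶ W.A) : (extend f).f = T.map f ≫ W.a := by
  simp [extend, Monad.adj]
  rfl

theorem unit_map_action {X : C} {W : T.Algebra} (f : X ⟶ W.A) :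
    T.η.app X ≫ T.map f ≫ W.a = f := by
  rw [← reassoc_of% unit_natural f, W.unit, Category.comp_id]

end

/-! ### Linton tensor products. -/

section Linton

variable {C : Type u} [Category.{v} C] {M : MonoidalCategory C} {T : Monad C}

/-- The structure maps of the forgetful functor present the tensor products of algebras as Linton
tensor products, and the unit as a free algebra. -/
structure IsLintonData (γ : LaxMonadStr M T) {S : MonoidalCategoryStruct T.Algebra}
    (L : LaxData S M T.forget) : Prop where
  one : Presents (A := S.tensorUnit) (𝟙 M.tensorUnit) (𝟙 M.tensorUnit)
    (T.η.app M.tensorUnit) L.one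
  ten : ∀ V W : T.Algebra, Presents (A := S.tensorObj V W) (T.η.app V.A ⊠ₘ[M] T.η.app W.A)
    (V.a ⊠ₘ[M] W.a) (γ.lax.φ V.A W.A) (L.ten V W)

theorem IsLintonData.generates [HasReflexiveCoequalizers C]
    [Monad.PreservesColimitOfIsReflexivePair T.toFunctor]
    (hM : Monad.PreservesColimitOfIsReflexivePair (@MonoidalCategory.tensor C _ M))
    {γ : LaxMonadStr M T} {S : MonoidalCategoryStruct T.Algebra} {L : LaxData S M T.forget}
    (h : IsLintonData γ L) : Generates (Presented T) L where
  ext := by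
    rintro X A B κ ⟨R, s, r, t, hκ⟩ k k' hk
    exact hκ.ext hk
  id A := ⟨_, _, _, _, presents_id A⟩
  tens := by
    rintro X Y A B κ l ⟨R, s, r, t, hκ⟩ ⟨R', s', r', t', hl⟩
    exact ⟨_, _, _, _, hκ.tens hM γ hl (h.ten A B)⟩
  one := ⟨_, _, _, _, h.one⟩

/-- By the free-forgetful adjunction, morphisms out of the free algebra on `V ⊗ W` that coequalize
the Linton pair correspond to bilinear maps out of `V ⊗ W`, and `u` is the universal one. -/
theorem isCoeq_of_presents (γ : LaxMonadStr M T) {V W Z : T.Algebra} {u : V.A ⊠[M] W.A ⟶ Z.A}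
    (h : Presents (T.η.app V.A ⊠ₘ[M] T.η.app W.A) (V.a ⊠ₘ[M] W.a) (γ.lax.φ V.A W.A) u) :
    IsCoeq (lintonFst γ V W) (lintonSnd M V W) (extend u) where
  w := by
    refine (presents_unit _).ext ?_
    rw [Monad.Algebra.comp_f, Monad.Algebra.comp_f, extend_f]
    dsimp only [lintonFst, lintonSnd, Monad.free]
    rw [← reassoc_of% unit_natural (V.a ⊠ₘ[M] W.a), ← reassoc_of% unit_natural u, Z.unit,
      Category.assoc, ← reassoc_of% unit_natural (γ.lax.φ V.A W.A), reassoc_of% T.left_unit]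
    exact h.w.trans (congrArg _ (Category.comp_id u).symm)
  desc {Z'} f hf := by
    let f' : T.obj (V.A ⊠[M] W.A) ⟶ Z'.A := f.f
    have hT : T.map f' ≫ Z'.a = T.μ.app (V.A ⊠[M] W.A) ≫ f' := f.h
    have hf' : (T.map (γ.lax.φ V.A W.A) ≫ T.μ.app (V.A ⊠[M] W.A)) ≫ f' =
        T.map (V.a ⊠ₘ[M] W.a) ≫ f' := congrArg Monad.Algebra.Hom.f hf
    have hf'' : T.map (T.η.app (V.A ⊠[M] W.A) ≫ f') ≫ Z'.a = f' := by
      rw [T.map_comp, Category.assoc, hT]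
      exact (reassoc_of% T.right_unit (V.A ⊠[M] W.A)) f'
    obtain ⟨k, hk⟩ := h.desc (Z := Z') (T.η.app (V.A ⊠[M] W.A) ≫ f') (by
      rw [hf'', reassoc_of% unit_natural (V.a ⊠ₘ[M] W.a), ← hf', Category.assoc,
        ← reassoc_of% unit_natural (γ.lax.φ V.A W.A), reassoc_of% T.left_unit])
    refine ⟨k, (presents_unit _).ext ?_⟩
    rw [Monad.Algebra.comp_f, extend_f]
    have h' : T.η.app (V.A ⊠[M] W.A) ≫ (T.map u ≫ Z.a) ≫ k.f =
        T.η.app (V.A ⊠[M] W.A) ≫ f' := by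
      rw [← Category.assoc, unit_map_action, hk]
    exact h'
  ext {Z' k k'} hk := by
    have h' := congrArg Monad.Algebra.Hom.f hk
    rw [Monad.Algebra.comp_f, Monad.Algebra.comp_f, extend_f] at h'
    have h'' : (T.map u ≫ Z.a) ≫ k.f = (T.map u ≫ Z.a) ≫ k'.f := h'
    refine h.ext ?_
    rw [← unit_map_action u, Category.assoc, h'']
    simp only [Category.assoc]

theorem exists_linton [HasReflexiveCoequalizers C]
    [Monad.PreservesColimitOfIsReflexivePair T.toFunctor]
    (hM : Monad.PreservesColimitOfIsReflexivePair (@MonoidalCategory.tensor C _ M))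
    (γ : LaxMonadStr M T) : ∃ (M' : MonoidalCategory T.Algebra) (u : LaxStr M' M T.forget),
      IsLintonTensor γ u ∧ IsLintonData γ u.data := by
  have hex : ∀ V W : T.Algebra, ∃ (Z : T.Algebra) (u : V.A ⊠[M] W.A ⟶ Z.A),
      Presents (T.η.app V.A ⊠ₘ[M] T.η.app W.A) (V.a ⊠ₘ[M] W.a) (γ.lax.φ V.A W.A) u := by
    intro V W
    obtain ⟨Z, u, h, -⟩ := exists_presents
      (s := T.η.app V.A ⊠ₘ[M] T.η.app W.A) (r := V.a ⊠ₘ[M] W.a) (t := γ.lax.φ V.A W.A)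
      (by rw [tens_comp, V.unit, W.unit]; exact tens_id M _ _) (γ.unit_tens _ _)
    exact ⟨Z, u, h⟩
  choose obj ten hten using hex
  have hhom : ∀ (A A' B B' : T.Algebra) (f : A ⟶ A') (g : B ⟶ B'),
      ∃ k : obj A B ⟶ obj A' B', ten A B ≫ k.f = (f.f ⊠ₘ[M] g.f) ≫ ten A' B' := by
    intro A A' B B' f g
    exact (hten A B).exists_covers (hten A' B').w (f.f ⊠ₘ[M] g.f) (T.map f.f ⊠ₘ[M] T.map g.f)
      (by rw [tens_comp, tens_comp, f.h, g.h]) (γ.φ_natural _ _).symm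
  choose hom hhom using hhom
  have hassoc : ∀ A B E : T.Algebra, ∃ k : obj (obj A B) E ≅ obj A (obj B E),
      Covers (U := T.forget) ((ten A B ⊠ₘ[M] 𝟙 E.A) ≫ ten _ _)
        ((𝟙 A.A ⊠ₘ[M] ten B E) ≫ ten _ _) (M.associator A.A B.A E.A).hom k.hom := by
    intro A B E
    -- By `Presents.tens`, each bracketing is presented by the triple product of underlying objects,
    -- with relations the triple product of their images under `T`. The associators of `C` match
    -- generators and relations, by associativity of `φ`.
    refine ((hten A B).tens hM γ (presents_id E) (hten _ _)).exists_covers_iso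
      ((presents_id A).tens hM γ (hten B E) (hten _ _)) (M.associator _ _ _)
      (M.associator _ _ _) ?_ ?_
    · exact MonoidalCategory.associator_naturality _ _ _
    · have h := γ.lax.data.assoc A.A B.A E.A
      simp only [Covers, Category.assoc] at h ⊢
      exact h
  choose assoc hassoc using hassoc
  let I : T.Algebra := T.free.obj M.tensorUnit
  have hleft : ∀ A : T.Algebra, ∃ k : obj I A ≅ A, Covers (U := T.forget)
      ((T.η.app M.tensorUnit ⊠ₘ[M] 𝟙 A.A) ≫ ten I A) (𝟙 A.A) (M.leftUnitor A.A).hom k.hom := by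
    intro A
    -- The free unit contributes only trivial relations, so the left unitors of `C` match both
    -- presentations, by unitality of `φ` and `φ₀ = η`.
    refine ((presents_unit M.tensorUnit).tens hM γ (presents_id A) (hten I A)).exists_covers_iso
      (presents_id A) (M.leftUnitor _) (M.leftUnitor _) ?_ ?_
    · rw [MonoidalCategory.id_tensorHom]
      exact MonoidalCategory.leftUnitor_naturality _
    · rw [← γ.φ₀_eq]
      exact γ.lax.data.left A.A
  choose left hleft using hleft
  have hright : ∀ A : T.Algebra, ∃ k : obj A I ≅ A, Covers (U := T.forget)
      ((𝟙 A.A ⊠ₘ[M] T.η.app M.tensorUnit) ≫ ten A I) (𝟙 A.A) (M.rightUnitor A.A).hom k.hom := by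
    intro A
    refine ((presents_id A).tens hM γ (presents_unit M.tensorUnit) (hten A I)).exists_covers_iso
      (presents_id A) (M.rightUnitor _) (M.rightUnitor _) ?_ ?_
    · rw [MonoidalCategory.tensorHom_id]
      exact MonoidalCategory.rightUnitor_naturality _
    · rw [← γ.φ₀_eq]
      exact γ.lax.data.right A.A
  choose right hright using hright
  let S : MonoidalCategoryStruct T.Algebra :=
    { tensorObj := obj
      tensorUnit := I
      tensorHom := fun f g => hom _ _ _ _ f g
      whiskerLeft := fun A _ _ f => hom _ _ _ _ (𝟙 A) f
      whiskerRight := fun f A => hom _ _ _ _ f (𝟙 A)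
      associator := assoc
      leftUnitor := left
      rightUnitor := right }
  let L : LaxData S M T.forget :=
    { one := T.η.app M.tensorUnit
      ten := ten
      natural := fun f g => hhom _ _ _ _ f g
      assoc := hassoc
      left := hleft
      right := hright }
  have hL : IsLintonData γ L := ⟨presents_unit _, hten⟩
  have G := hL.generates hM
  exact ⟨L.monoidal G (fun _ _ _ _ => rfl) (fun _ _ => rfl),
    L.lax G (fun _ _ _ _ => rfl) (fun _ _ => rfl),
    ⟨⟨rfl, (Category.comp_id _).symm⟩, 
      fun V W => ⟨_, (isCoeq_of_presents γ (hten V W)).nonempty_isColimit⟩⟩,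
    ⟨hL.one, hL.ten⟩⟩

end Linton

/-! ### Lifted tensor products. -/

section Colax

variable {C : Type u} [Category.{v} C] {M : MonoidalCategory C} {T : Monad C}

theorem ColaxMonadStr.ψ_natural (γ : ColaxMonadStr M T) {X Y X' Y' : C} (f : X ⟶ Y)
    (g : X' ⟶ Y') : γ.colax.ψ X X' ≫ (T.map f ⊠ₘ[M] T.map g) =
      T.map (f ⊠ₘ[M] g) ≫ γ.colax.ψ Y Y' :=
  let := γ.colax
  Functor.OplaxMonoidal.δ_natural T.toFunctor f g

/-- The structure maps of the forgetful functor are isomorphisms from the tensor products and the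
unit of the base, with their canonical actions. -/
structure IsLiftedData (γ : ColaxMonadStr M T) {S : MonoidalCategoryStruct T.Algebra}
    (L : LaxData S M T.forget) : Prop where
  isIso_one : IsIso L.one
  isIso_ten : ∀ V W : T.Algebra, IsIso (L.ten V W)
  one : T.map L.one ≫ S.tensorUnit.a = γ.colax.ψ₀ ≫ L.one
  ten : ∀ V W : T.Algebra, T.map (L.ten V W) ≫ (S.tensorObj V W).a =
    γ.colax.ψ V.A W.A ≫ (V.a ⊠ₘ[M] W.a) ≫ L.ten V W

variable (T) in
/-- The isomorphisms onto the underlying object of an algebra. -/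
def IsoClass : MapClass T.forget := fun _ _ g => IsIso g

/-- The link between the two generating classes, needed when a Linton structure is paired with a
lifted one. -/
theorem isoClass_le_presented ⦃X : C⦄ ⦃A : T.Algebra⦄ ⦃g : X ⟶ T.forget.obj A⦄
    (h : IsoClass T g) : Presented T g :=
  have h' : ∀ g : X ⟶ A.A, IsIso g → Presented T (A := A) g := fun g _ =>
    ⟨_, _, _, _, presents_of_isIso (r := T.map g ≫ A.a ≫ inv g) g (by simp)⟩
  h' g h

/-- Isomorphisms are stable under every tensor product, so no preservation of coequalizers is
required. -/
theorem IsLiftedData.generates {γ : ColaxMonadStr M T} {S : MonoidalCategoryStruct T.Algebra}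
    {L : LaxData S M T.forget} (h : IsLiftedData γ L) : Generates (IsoClass T) L where
  ext {X A B κ} hκ {k k'} hk := by
    have : IsIso κ := hκ
    exact T.forget.map_injective ((cancel_epi κ).1 hk)
  id A := inferInstanceAs (IsIso (𝟙 _))
  tens {X Y A B κ l} hκ hl := by
    have : IsIso κ := hκ
    have : IsIso l := hl
    have := h.isIso_ten A B
    exact inferInstanceAs (IsIso ((κ ⊠ₘ[M] l) ≫ L.ten A B))
  one := h.isIso_one

theorem IsLiftedData.presents_one {γ : ColaxMonadStr M T} {S : MonoidalCategoryStruct T.Algebra}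
    {L : LaxData S M T.forget} (h : IsLiftedData γ L) :
    Presents (A := S.tensorUnit) (T.η.app M.tensorUnit) γ.colax.ψ₀ (𝟙 _) L.one :=
  have : @IsIso C _ M.tensorUnit S.tensorUnit.A L.one := h.isIso_one
  presents_of_isIso _ h.one

theorem ColaxMonadStr.action_tens (γ : ColaxMonadStr M T) {X Y : C} {A B Z : T.Algebra}
    {u : A.A ⊠[M] B.A ⟶ Z.A}
    (hu : T.map u ≫ Z.a = γ.colax.ψ A.A B.A ≫ (A.a ⊠ₘ[M] B.a) ≫ u) (κ : X ⟶ A.A) (l : Y ⟶ B.A) :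
    T.map ((κ ⊠ₘ[M] l) ≫ u) ≫ Z.a =
      γ.colax.ψ X Y ≫ ((T.map κ ≫ A.a) ⊠ₘ[M] (T.map l ≫ B.a)) ≫ u := by
  rw [T.map_comp, Category.assoc, hu, ← reassoc_of% γ.ψ_natural, tens_comp_assoc]

theorem ColaxMonadStr.action_tens_eq (γ : ColaxMonadStr M T) {X Y : C} {A B Z : T.Algebra}
    {u : A.A ⊠[M] B.A ⟶ Z.A}
    (hu : T.map u ≫ Z.a = γ.colax.ψ A.A B.A ≫ (A.a ⊠ₘ[M] B.a) ≫ u) {κ : X ⟶ A.A} {l : Y ⟶ B.A}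
    {r : T.obj X ⟶ X} {r' : T.obj Y ⟶ Y} (hκ : T.map κ ≫ A.a = r ≫ κ)
    (hl : T.map l ≫ B.a = r' ≫ l) :
    T.map ((κ ⊠ₘ[M] l) ≫ u) ≫ Z.a = (γ.colax.ψ X Y ≫ (r ⊠ₘ[M] r')) ≫ (κ ⊠ₘ[M] l) ≫ u := by
  rw [γ.action_tens hu, hκ, hl, Category.assoc, tens_comp_assoc]

theorem IsLiftedData.action_tens_eq {γ : ColaxMonadStr M T}
    {S : MonoidalCategoryStruct T.Algebra} {L : LaxData S M T.forget} (h : IsLiftedData γ L)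
    {X Y : C} {A B : T.Algebra} {κ : X ⟶ A.A} {l : Y ⟶ B.A} {r : T.obj X ⟶ X}
    {r' : T.obj Y ⟶ Y} (hκ : T.map κ ≫ A.a = r ≫ κ) (hl : T.map l ≫ B.a = r' ≫ l) :
    T.map (L.tens (A := A) (B := B) κ l) ≫ (S.tensorObj A B).a =
      (γ.colax.ψ X Y ≫ (r ⊠ₘ[M] r')) ≫ L.tens (A := A) (B := B) κ l :=
  γ.action_tens_eq (h.ten A B) hκ hl

theorem IsLiftedData.presents_tens {γ : ColaxMonadStr M T}
    {S : MonoidalCategoryStruct T.Algebra} {L : LaxData S M T.forget} (h : IsLiftedData γ L)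
    {X Y : C} {A B : T.Algebra} {κ : X ⟶ A.A} {l : Y ⟶ B.A} (iκ : IsIso κ)
    (il : IsIso l) {r : T.obj X ⟶ X} {r' : T.obj Y ⟶ Y} (hκ : T.map κ ≫ A.a = r ≫ κ)
    (hl : T.map l ≫ B.a = r' ≫ l) :
    Presents (A := S.tensorObj A B) (T.η.app (X ⊠[M] Y)) (γ.colax.ψ X Y ≫ (r ⊠ₘ[M] r')) (𝟙 _)
      (L.tens (A := A) (B := B) κ l) :=
  have : @IsIso C _ (X ⊠[M] Y) (S.tensorObj A B).A (L.tens (A := A) (B := B) κ l) :=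
    h.generates.tens (A := A) (B := B) iκ il
  presents_of_isIso _ (h.action_tens_eq hκ hl)

theorem IsLiftedData.presents_ten {γ : ColaxMonadStr M T}
    {S : MonoidalCategoryStruct T.Algebra} {L : LaxData S M T.forget} (h : IsLiftedData γ L)
    (A B : T.Algebra) :
    Presents (A := S.tensorObj A B) (T.η.app (A.A ⊠[M] B.A))
      (γ.colax.ψ A.A B.A ≫ (A.a ⊠ₘ[M] B.a)) (𝟙 _) (L.ten A B) :=
  have : @IsIso C _ (A.A ⊠[M] B.A) (S.tensorObj A B).A (L.ten A B) := h.isIso_ten A B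
  presents_of_isIso _ ((h.ten A B).trans (Category.assoc _ _ _).symm)

/-- The coherence isomorphisms of `M` are algebra morphisms by coassociativity and counitality of
`ψ`; the structure maps of the forgetful functor are identities. -/
theorem exists_lifted (γ : ColaxMonadStr M T) :
    ∃ (M' : MonoidalCategory T.Algebra) (u : LaxStr M' M T.forget),
      IsLiftedTensor γ u ∧ IsLiftedData γ u.data := by
  let K := γ.colax
  let ten := tensorAlgebra γ
  let hom {V V' W W' : T.Algebra} (f : V ⟶ V') (g : W ⟶ W') : ten V W ⟶ ten V' W' :=
    { f := f.f ⊠ₘ[M] g.f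
      h := by
        dsimp only [ten, tensorAlgebra]
        rw [← reassoc_of% γ.ψ_natural, Category.assoc, tens_comp, tens_comp, f.h, g.h] }
  let I := unitAlgebra γ
  let S : MonoidalCategoryStruct T.Algebra :=
    { tensorObj := ten
      tensorUnit := I
      tensorHom := hom
      whiskerLeft := fun A _ _ f => hom (𝟙 A) f
      whiskerRight := fun f A => hom f (𝟙 A)
      associator := fun A B E => Monad.Algebra.isoMk (M.associator A.A B.A E.A) (by
        have h : γ.colax.ψ (A.A ⊠[M] B.A) E.A ≫ (γ.colax.ψ A.A B.A ⊠ₘ[M] 𝟙 (T.obj E.A)) ≫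
            (M.associator _ _ _).hom = T.map (M.associator A.A B.A E.A).hom ≫
              γ.colax.ψ A.A (B.A ⊠[M] E.A) ≫ (𝟙 (T.obj A.A) ⊠ₘ[M] γ.colax.ψ B.A E.A) := by
          simp
        dsimp only [ten, tensorAlgebra]
        rw [← Category.id_comp A.a, ← tens_comp, ← reassoc_of% h,
          ← MonoidalCategory.associator_naturality, tens_comp_assoc, Category.id_comp,
          Category.id_comp, Category.assoc])
      leftUnitor := fun A => Monad.Algebra.isoMk (M.leftUnitor A.A) (by
        have h : γ.colax.ψ M.tensorUnit A.A ≫ (γ.colax.ψ₀ ⊠ₘ[M] 𝟙 (T.obj A.A)) ≫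
            (M.leftUnitor (T.obj A.A)).hom = T.map (M.leftUnitor A.A).hom := by
          simp
        have h' : (γ.colax.ψ₀ ⊠ₘ[M] A.a) ≫ (M.leftUnitor A.A).hom =
            (γ.colax.ψ₀ ⊠ₘ[M] 𝟙 (T.obj A.A)) ≫ (M.leftUnitor (T.obj A.A)).hom ≫ A.a := by
          rw [MonoidalCategory.tensorHom_def, Category.assoc,
            MonoidalCategory.leftUnitor_naturality, MonoidalCategory.tensorHom_id]
        dsimp only [ten, tensorAlgebra, I, unitAlgebra]
        rw [Category.assoc, h', reassoc_of% h])
      rightUnitor := fun A => Monad.Algebra.isoMk (M.rightUnitor A.A) (by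
        have h : γ.colax.ψ A.A M.tensorUnit ≫ (𝟙 (T.obj A.A) ⊠ₘ[M] γ.colax.ψ₀) ≫
            (M.rightUnitor (T.obj A.A)).hom = T.map (M.rightUnitor A.A).hom := by
          simp
        have h' : (A.a ⊠ₘ[M] γ.colax.ψ₀) ≫ (M.rightUnitor A.A).hom =
            (𝟙 (T.obj A.A) ⊠ₘ[M] γ.colax.ψ₀) ≫ (M.rightUnitor (T.obj A.A)).hom ≫ A.a := by
          rw [MonoidalCategory.tensorHom_def', Category.assoc,
            MonoidalCategory.rightUnitor_naturality, MonoidalCategory.id_tensorHom]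
        dsimp only [ten, tensorAlgebra, I, unitAlgebra]
        rw [Category.assoc, h', reassoc_of% h]) }
  let L : LaxData S M T.forget :=
    { one := 𝟙 M.tensorUnit
      ten := fun V W => 𝟙 (V.A ⊠[M] W.A)
      natural := fun f g => (Category.id_comp _).trans (Category.comp_id _).symm
      assoc := fun A B E => by
        have h : ((𝟙 _ ⊠ₘ[M] 𝟙 _) ≫ 𝟙 _) ≫ (M.associator A.A B.A E.A).hom =
            (M.associator A.A B.A E.A).hom ≫ (𝟙 _ ⊠ₘ[M] 𝟙 _) ≫ 𝟙 _ := by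
          simp
        exact h
      left := fun A => by
        have h : ((𝟙 _ ⊠ₘ[M] 𝟙 _) ≫ 𝟙 _) ≫ (M.leftUnitor A.A).hom =
            (M.leftUnitor A.A).hom ≫ 𝟙 _ := by
          simp
        exact h
      right := fun A => by
        have h : ((𝟙 _ ⊠ₘ[M] 𝟙 _) ≫ 𝟙 _) ≫ (M.rightUnitor A.A).hom =
            (M.rightUnitor A.A).hom ≫ 𝟙 _ := by
          simp
        exact h }
  have hL : IsLiftedData γ L :=
    { isIso_one := inferInstanceAs (IsIso (𝟙 M.tensorUnit))
      isIso_ten := fun V W => inferInstanceAs (IsIso (𝟙 (V.A ⊠[M] W.A)))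
      one := by
        have h : T.map (𝟙 M.tensorUnit) ≫ γ.colax.ψ₀ = γ.colax.ψ₀ ≫ 𝟙 M.tensorUnit := by simp
        exact h
      ten := fun V W => by
        have h : T.map (𝟙 (V.A ⊠[M] W.A)) ≫ γ.colax.ψ V.A W.A ≫ (V.a ⊠ₘ[M] W.a) =
          γ.colax.ψ V.A W.A ≫ (V.a ⊠ₘ[M] W.a) ≫ 𝟙 _ := by simp
        exact h }
  have G := hL.generates
  exact ⟨L.monoidal G (fun _ _ _ _ => rfl) (fun _ _ => rfl),
    L.lax G (fun _ _ _ _ => rfl) (fun _ _ => rfl), ⟨⟨rfl, rfl⟩, fun V W => ⟨rfl, rfl⟩⟩,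
    ⟨hL.isIso_one, hL.isIso_ten, hL.one, hL.ten⟩⟩

end Colax

/-! ### Lifting interchange laws and unit maps. -/

section Interchange

variable {C : Type u} [Category.{v} C] {M N : MonoidalCategory C} {T : Monad C}
  {M' N' : MonoidalCategory T.Algebra} {L : LaxData M'.toMonoidalCategoryStruct M T.forget}
  {K : LaxData N'.toMonoidalCategoryStruct N T.forget} {S : DuoidalStr M N}

/-- The unit is free on `I`, so `Δ` and `ι` extend with no condition to verify. -/
theorem IsLintonData.exists_covers_one {γ : LaxMonadStr M T} (hL : IsLintonData γ L) {X : C}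
    {A : T.Algebra} (g : X ⟶ A.A) (m : M.tensorUnit ⟶ X) :
    ∃ k : M'.tensorUnit ⟶ A, Covers (U := T.forget) L.one g m k :=
  hL.one.desc (Z := A) (m ≫ g) ((unit_map_action _).trans (Category.id_comp _).symm)

theorem nonempty_duoidalLift_of_isDoubleLax [HasReflexiveCoequalizers C]
    [Monad.PreservesColimitOfIsReflexivePair T.toFunctor]
    (hM : Monad.PreservesColimitOfIsReflexivePair (@MonoidalCategory.tensor C _ M))
    (hN : Monad.PreservesColimitOfIsReflexivePair (@MonoidalCategory.tensor C _ N))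
    {γ : LaxMonadStr M T} {δ : LaxMonadStr N T} (hL : IsLintonData γ L) (hK : IsLintonData δ K)
    (h : IsDoubleLax S S γ.lax δ.lax) : Nonempty (DuoidalLift S L K) := by
  have hζ : ∀ A B X Y : T.Algebra,
      ∃ k : (A ⊠[N'] B) ⊠[M'] (X ⊠[N'] Y) ⟶ (A ⊠[M'] X) ⊠[N'] (B ⊠[M'] Y),
        Covers (L.tens (K.ten A B) (K.ten X Y)) (K.tens (L.ten A X) (L.ten B Y))
          -- The map on relations is again `ζ`, now at the objects `T A`, `T B`, `T X`, `T Y`.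
          -- Naturality handles the actions and the double monoidal law handles `φ`.
          (S.ζ A.A B.A X.A Y.A) k := fun A B X Y =>
    ((hK.ten A B).tens hM γ (hK.ten X Y) (hL.ten _ _)).exists_covers
      ((hL.ten A X).tens hN δ (hL.ten B Y) (hK.ten _ _)).w (S.ζ _ _ _ _) (S.ζ _ _ _ _)
      (S.ζ_natural _ _ _ _) ((Category.assoc _ _ _).trans (h.interchange _ _ _ _))
  choose ζ hζ using hζ
  obtain ⟨Δ, hΔ⟩ := hL.exists_covers_one (K.tens L.one L.one) S.Δ
  obtain ⟨ι, hι⟩ := hL.exists_covers_one K.one S.ι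
  -- The product of two free units has only trivial relations, so every map out of its generators
  -- extends.
  have hθ : ∀ (Z : T.Algebra) (f : N.tensorUnit ⊠[M] N.tensorUnit ⟶ Z.A),
      ((T.η.app N.tensorUnit ⊠ₘ[M] T.η.app N.tensorUnit) ≫ γ.lax.φ _ _) ≫ T.map f ≫ Z.a =
        (𝟙 _ ⊠ₘ[M] 𝟙 _) ≫ f := fun Z f => by
    rw [γ.unit_tens, tens_id M, unit_map_action, Category.id_comp]
  obtain ⟨θ, hθ⟩ := (hK.one.tens hM γ hK.one (hL.ten _ _)).desc (Z := N'.tensorUnit)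
    (S.θ ≫ K.one) (hθ _ _)
  exact ⟨⟨ζ, Δ, θ, ι, hζ, hΔ, hθ, hι⟩⟩

/-- The bimonoidal law turns `ψ ∘ T ζ ∘ φ` into `(φ ⋆ φ) ∘ ζ ∘ (ψ ⋄ ψ)`. The bilinearity of `f` and
`g` then absorbs `φ ⋆ φ`, and naturality of `ζ` moves the actions to the front. -/
theorem IsBilax.linear_ζ {γ : LaxMonadStr M T} {δ : ColaxMonadStr N T}
    (h : IsBilax S S γ.lax δ.colax) {A B X Y P Q Z : T.Algebra} {f : A.A ⊠[M] X.A ⟶ P.A}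
    {g : B.A ⊠[M] Y.A ⟶ Q.A} {u : P.A ⊠[N] Q.A ⟶ Z.A}
    (hf : γ.lax.φ A.A X.A ≫ T.map f ≫ P.a = (A.a ⊠ₘ[M] X.a) ≫ f)
    (hg : γ.lax.φ B.A Y.A ≫ T.map g ≫ Q.a = (B.a ⊠ₘ[M] Y.a) ≫ g)
    (hu : T.map u ≫ Z.a = δ.colax.ψ P.A Q.A ≫ (P.a ⊠ₘ[N] Q.a) ≫ u) :
    ((𝟙 _ ⊠ₘ[M] 𝟙 _) ≫ γ.lax.φ (A.A ⊠[N] B.A) (X.A ⊠[N] Y.A)) ≫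
        T.map (S.ζ A.A B.A X.A Y.A ≫ (f ⊠ₘ[N] g) ≫ u) ≫ Z.a =
      ((δ.colax.ψ A.A B.A ≫ (A.a ⊠ₘ[N] B.a)) ⊠ₘ[M] (δ.colax.ψ X.A Y.A ≫ (X.a ⊠ₘ[N] Y.a))) ≫
        S.ζ A.A B.A X.A Y.A ≫ (f ⊠ₘ[N] g) ≫ u := by
  have h' := h.interchange A.A B.A X.A Y.A
  rw [tens_id M, Category.id_comp, T.map_comp, Category.assoc, δ.action_tens hu,
    reassoc_of% h', tens_comp_assoc N, hf, hg, ← tens_comp_assoc N, ← reassoc_of% S.ζ_natural,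
    tens_comp_assoc M]

theorem IsBilax.linear_θ {γ : LaxMonadStr M T} {δ : ColaxMonadStr N T}
    (h : IsBilax S S γ.lax δ.colax) {Z : T.Algebra} {u : N.tensorUnit ⟶ Z.A}
    (hu : T.map u ≫ Z.a = δ.colax.ψ₀ ≫ u) :
    ((𝟙 _ ⊠ₘ[M] 𝟙 _) ≫ γ.lax.φ N.tensorUnit N.tensorUnit) ≫ T.map (S.θ ≫ u) ≫ Z.a =
      (δ.colax.ψ₀ ⊠ₘ[M] δ.colax.ψ₀) ≫ S.θ ≫ u := by
  have h' := h.unit_second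
  rw [tens_id M, Category.id_comp, T.map_comp, Category.assoc, hu, reassoc_of% h']

theorem nonempty_duoidalLift_of_isBilax [HasReflexiveCoequalizers C]
    [Monad.PreservesColimitOfIsReflexivePair T.toFunctor]
    (hM : Monad.PreservesColimitOfIsReflexivePair (@MonoidalCategory.tensor C _ M))
    {γ : LaxMonadStr M T} {δ : ColaxMonadStr N T} (hL : IsLintonData γ L)
    (hK : IsLiftedData δ K) (h : IsBilax S S γ.lax δ.colax) : Nonempty (DuoidalLift S L K) := by
  have hζ : ∀ A B X Y : T.Algebra,
      ∃ k : (A ⊠[N'] B) ⊠[M'] (X ⊠[N'] Y) ⟶ (A ⊠[M'] X) ⊠[N'] (B ⊠[M'] Y),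
        Covers (L.tens (K.ten A B) (K.ten X Y)) (K.tens (L.ten A X) (L.ten B Y))
          (S.ζ A.A B.A X.A Y.A) k := by
    intro A B X Y
    exact ((hK.presents_ten A B).tens hM γ (hK.presents_ten X Y) (hL.ten _ _)).desc
      (Z := (A ⊠[M'] X) ⊠[N'] (B ⊠[M'] Y)) (S.ζ A.A B.A X.A Y.A ≫ K.tens (L.ten A X) (L.ten B Y))
      (h.linear_ζ (hL.ten A X).w (hL.ten B Y).w (hK.ten _ _))
  choose ζ hζ using hζ
  obtain ⟨Δ, hΔ⟩ := hL.exists_covers_one (K.tens L.one L.one) S.Δ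
  obtain ⟨ι, hι⟩ := hL.exists_covers_one K.one S.ι
  obtain ⟨θ, hθ⟩ := (hK.presents_one.tens hM γ hK.presents_one (hL.ten _ _)).desc
    (Z := N'.tensorUnit) (S.θ ≫ K.one) (h.linear_θ hK.one)
  exact ⟨⟨ζ, Δ, θ, ι, hζ, hΔ, hθ, hι⟩⟩

/-- In other words, `ζ` is a morphism of algebras for the lifted actions. -/
theorem IsDoubleColax.linear_ζ {γ : ColaxMonadStr M T} {δ : ColaxMonadStr N T}
    (h : IsDoubleColax S S γ.colax δ.colax) (A B X Y : T.Algebra) :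
    (γ.colax.ψ (A.A ⊠[N] B.A) (X.A ⊠[N] Y.A) ≫
        ((δ.colax.ψ A.A B.A ≫ (A.a ⊠ₘ[N] B.a)) ⊠ₘ[M] (δ.colax.ψ X.A Y.A ≫ (X.a ⊠ₘ[N] Y.a)))) ≫
        S.ζ A.A B.A X.A Y.A =
      T.map (S.ζ A.A B.A X.A Y.A) ≫ δ.colax.ψ (A.A ⊠[M] X.A) (B.A ⊠[M] Y.A) ≫
        ((γ.colax.ψ A.A X.A ≫ (A.a ⊠ₘ[M] X.a)) ⊠ₘ[N] (γ.colax.ψ B.A Y.A ≫ (B.a ⊠ₘ[M] Y.a))) := by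
  have h' := h.interchange A.A B.A X.A Y.A
  rw [← tens_comp M, ← tens_comp N, Category.assoc, Category.assoc, S.ζ_natural, reassoc_of% h']

theorem nonempty_duoidalLift_of_isDoubleColax
    {γ : ColaxMonadStr M T} {δ : ColaxMonadStr N T} (hL : IsLiftedData γ L)
    (hK : IsLiftedData δ K) (h : IsDoubleColax S S γ.colax δ.colax) :
    Nonempty (DuoidalLift S L K) := by
  have hten (A B : T.Algebra) : T.map (L.ten A B) ≫ (A ⊠[M'] B).a =
      (γ.colax.ψ A.A B.A ≫ (A.a ⊠ₘ[M] B.a)) ≫ L.ten A B :=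
    (hL.ten A B).trans (Category.assoc _ _ _).symm
  have hten' (A B : T.Algebra) : T.map (K.ten A B) ≫ (A ⊠[N'] B).a =
      (δ.colax.ψ A.A B.A ≫ (A.a ⊠ₘ[N] B.a)) ≫ K.ten A B :=
    (hK.ten A B).trans (Category.assoc _ _ _).symm
  have hζ : ∀ A B X Y : T.Algebra,
      ∃ k : (A ⊠[N'] B) ⊠[M'] (X ⊠[N'] Y) ⟶ (A ⊠[M'] X) ⊠[N'] (B ⊠[M'] Y),
        Covers (L.tens (K.ten A B) (K.ten X Y)) (K.tens (L.ten A X) (L.ten B Y))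
          (S.ζ A.A B.A X.A Y.A) k := by
    intro A B X Y
    -- In a tautological presentation `t` is the identity, so the map on relations is forced to be
    -- `T ζ`.
    exact (hL.presents_tens (hK.isIso_ten A B) (hK.isIso_ten X Y) (hten' A B)
        (hten' X Y)).exists_covers
      ((Category.id_comp _).trans (hK.action_tens_eq (hten A X) (hten B Y))) (S.ζ _ _ _ _)
      (T.map (S.ζ _ _ _ _)) (h.linear_ζ A B X Y)
      ((Category.id_comp _).trans (Category.comp_id _).symm)
  choose ζ hζ using hζ
  obtain ⟨Δ, hΔ⟩ := hL.presents_one.exists_covers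
    ((Category.id_comp _).trans (hK.action_tens_eq hL.one hL.one)) S.Δ (T.map S.Δ)
    h.unit_first.symm ((Category.id_comp _).trans (Category.comp_id _).symm)
  obtain ⟨ι, hι⟩ := hL.presents_one.exists_covers ((Category.id_comp _).trans hK.one) S.ι
    (T.map S.ι) h.unit_unit.symm ((Category.id_comp _).trans (Category.comp_id _).symm)
  obtain ⟨θ, hθ⟩ := (hL.presents_tens hK.isIso_one hK.isIso_one hK.one hK.one).exists_covers
    ((Category.id_comp _).trans hK.one) S.θ (T.map S.θ)
    ((Category.assoc _ _ _).trans h.unit_second)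
    ((Category.id_comp _).trans (Category.comp_id _).symm)
  exact ⟨⟨ζ, Δ, θ, ι, hζ, hΔ, hθ, hι⟩⟩

end Interchange

end HigherMonoidal

/-! ### Assembling the structures. -/

theorem theoremt {C : Type u} [Category.{v} C] [HasReflexiveCoequalizers C]
    {n p q : ℕ} (hpq : p + q = n) (S : NMonoidalStr C n)
    (T : Monad C) (γ : PQMonadStr S p T)
    [Monad.PreservesColimitOfIsReflexivePair T.toFunctor]
    (htensor : ∀ i : Fin n, i.val < p →
      Monad.PreservesColimitOfIsReflexivePair
        (@MonoidalCategory.tensor C _ (S.mon i))) :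
    ∃ (S' : NMonoidalStr T.Algebra n)
      (U : ∀ i : Fin n, LaxStr (S'.mon i) (S.mon i) T.forget),
      (∀ (i : Fin n) (hi : i.val < p), IsLintonTensor (γ.lax i hi) (U i)) ∧
      (∀ (i : Fin n) (hi : p ≤ i.val), IsLiftedTensor (γ.colax i hi) (U i)) ∧
      (∀ (i j : Fin n) (hij : i < j),
        IsDoubleLax (S'.duo i j hij) (S.duo i j hij) (U i) (U j)) := by
  have hmon : ∀ i : Fin n, ∃ (M' : MonoidalCategory T.Algebra)
      (u : LaxStr M' (S.mon i) T.forget),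
      (∀ hi : i.val < p, IsLintonTensor (γ.lax i hi) u ∧ IsLintonData (γ.lax i hi) u.data) ∧
      (∀ hi : p ≤ i.val, IsLiftedTensor (γ.colax i hi) u ∧
        IsLiftedData (γ.colax i hi) u.data) := by
    intro i
    rcases lt_or_ge i.val p with hi | hi
    · obtain ⟨M', u, h⟩ := exists_linton (htensor i hi) (γ.lax i hi)
      exact ⟨M', u, fun _ => h, fun hi' => absurd hi (not_lt.2 hi')⟩
    · obtain ⟨M', u, h⟩ := exists_lifted (γ.colax i hi)
      exact ⟨M', u, fun hi' => absurd hi (not_le.2 hi'), fun _ => h⟩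
  choose mon U hlax hcolax using hmon
  -- Presented maps for Linton structures, isomorphisms for lifted ones; since the Linton structures
  -- come first, `Q j` is contained in `Q i` for `i < j`.
  let Q (i : Fin n) : MapClass T.forget := if i.val < p then Presented T else IsoClass T
  have hQ : ∀ i, Generates (Q i) (U i).data := by
    intro i
    rcases lt_or_ge i.val p with hi | hi
    · simpa only [Q, if_pos hi] using (hlax i hi).2.generates (htensor i hi)
    · simpa only [Q, if_neg (not_lt.2 hi)] using (hcolax i hi).2.generates
  have hQ' : ∀ i j : Fin n, i < j → ∀ ⦃X : C⦄ ⦃A : T.Algebra⦄ ⦃κ : X ⟶ T.forget.obj A⦄,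
      Q j κ → Q i κ := by
    intro i j hij X A κ h
    have hij' : i.val < j.val := hij
    rcases lt_or_ge j.val p with hj | hj
    · rw [show Q i = Presented T from if_pos (hij'.trans hj)]
      rwa [show Q j = Presented T from if_pos hj] at h
    · rw [show Q j = IsoClass T from if_neg (not_lt.2 hj)] at h
      rcases lt_or_ge i.val p with hi | hi
      · rw [show Q i = Presented T from if_pos hi]
        exact isoClass_le_presented h
      · rwa [show Q i = IsoClass T from if_neg (not_lt.2 hi)]
  have hduo : ∀ i j : Fin n, ∀ hij : i < j,
      Nonempty (DuoidalLift (S.duo i j hij) (U i).data (U j).data) := by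
    intro i j hij
    have hij' : i.val < j.val := hij
    rcases lt_or_ge j.val p with hj | hj
    · have hi := hij'.trans hj
      exact nonempty_duoidalLift_of_isDoubleLax (htensor i hi) (htensor j hj) (hlax i hi).2
        (hlax j hj).2 (γ.isDoubleLax i j hij hi hj)
    · rcases lt_or_ge i.val p with hi | hi
      · exact nonempty_duoidalLift_of_isBilax (htensor i hi) (hlax i hi).2 (hcolax j hj).2
          (γ.isBilax i j hij hi hj)
      · exact nonempty_duoidalLift_of_isDoubleColax (hcolax i hi).2 (hcolax j hj).2
          (γ.isDoubleColax i j hij hi hj)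
  have H := fun i j hij => (hduo i j hij).some
  have hH := fun i j hij => (H i j hij).isDoubleLax (hQ i) (hQ j) (hQ' i j hij)
  exact ⟨⟨mon, fun i j hij => (H i j hij).duoidal (hQ i) (hQ j) (hQ' i j hij),
    fun i j k hij hjk => (S.tri i j k hij hjk).of_isDoubleLax (hH i j hij)
      (hH i k (hij.trans hjk)) (hH j k hjk) (hQ i) (hQ j) (hQ k) (hQ' i j hij) (hQ' j k hjk)⟩,
    U, fun i hi => (hlax i hi).1, fun i hi => (hcolax i hi).1, hH⟩
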